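/- Let $(M,\varphi,\xi,\eta,g)$ be a connected smooth $3$-dimensional almost Kenmotsu manifold. That is, $\varphi$ is a smooth $(1,1)$-tensor field, $\xi$ a smooth vector field, $\eta$ a smooth $1$-form and $g$ a Riemannian metric on $M$ with $\varphi^2=-I+\eta\otimes\xi$, $\eta(\xi)=1$, $g(\varphi X,\varphi Y)=g(X,Y)-\eta(X)\eta(Y)$, and $d\eta=0$, $d\Phi=2\,\eta\wedge\Phi$, where $\Phi(X,Y)=g(X,\varphi Y)$. Put $h=\tfrac12\mathcal L_\xi\varphi$ and $h'=h\circ\varphi$, and let $R_{XY}Z=\nabla_X\nabla_YZ-\nabla_Y\nabla_XZ-\nabla_{[X,Y]}Z$ be the curvature of the Levi-Civita connection of $g$. Let $k,\mu$ be smooth functions on $M$ such that either $$R_{XY}\xi=k\big(\eta(Y)X-\eta(X)Y\big)+\mu\big(\eta(Y)hX-\eta(X)hY\big)\quad\text{for all vector fields }X,Y,$$ or $$R_{XY}\xi=k\big(\eta(Y)X-\eta(X)Y\big)+\mu\big(\eta(Y)h'X-\eta(X)h'Y\big)\quad\text{for all vector fields }X,Y.$$ Assume that $dk\wedge\eta=0$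 and that $k<-1$ everywhere on $M$. Let $i:N\to M$ be a leaf of the canonical foliation of $M$, i.e. a maximal connected integral manifold (an injectively immersed connected surface) of the distribution $\ker\eta$. Let $G=i^*g$ be the induced metric, and let $J$ be the almost complex structure induced by $\varphi$, given by $di\circ J=\varphi\circ di$. Then $(N,J,G)$ is a flat Kähler manifold: $(J,G)$ is a smooth almost Hermitian structure, $J$ is integrable (its Nijenhuis tensor vanishes), the fundamental $2$-form $G(\cdot,J\cdot)$ is closed, and the curvature tensor of $G$ vanishes identically. -/

import Mathlib

open Bundle
open scoped Manifold ContDiff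

noncomputable section
namespace AlmostKenmotsu
variable {E : Type*} [NormedAddCommGroup E] [NormedSpace ℝ E]
  {H : Type*} [TopologicalSpace H] {I : ModelWithCorners ℝ E H}
  {M : Type*} [TopologicalSpace M] [ChartedSpace H M] [IsManifold I ∞ M]


/-! ### Riemannian metrics and the Levi-Civita connection -/

variable (I M) in
/-- A smooth Riemannian metric on the manifold `M`. -/
abbrev RiemannianMetric :=
  Bundle.ContMDiffRiemannianMetric I ∞ E (TangentSpace I : M → Type _)

/-- The function `g(X, Y)` for two vector fields `X`, `Y`. -/
def RiemannianMetric.onFields (g : RiemannianMetric I M) (X Y : Π x : M, TangentSpace I x) :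
    M → ℝ :=
  fun x => g.inner x (X x) (Y x)

lemma mdifferentiableAt_metric (g : RiemannianMetric I M) {X Y : Π x : M, TangentSpace I x} {x : M}
    (hX : MDiffAt (T% X) x) (hY : MDiffAt (T% Y) x) :
    MDiffAt (g.onFields X Y) x := by
  have h : MDifferentiableAt I (I.prod 𝓘(ℝ, ℝ))
      (fun m ↦ TotalSpace.mk' ℝ (E := Bundle.Trivial M ℝ) m (g.inner m (X m) (Y m))) x :=
    MDifferentiableAt.clm_bundle_apply₂ (F₁ := E) (F₂ := E) (b := fun m => m)
      (g.contMDiff.mdifferentiableAt (by simp)) hX hY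
  simp only [mdifferentiableAt_totalSpace] at h
  exact h.2

/-- The right-hand side of the Koszul formula,
`X g(Y,Z) + Y g(X,Z) - Z g(X,Y) + g([X,Y],Z) - g([X,Z],Y) - g([Y,Z],X)`. -/
def koszul (g : RiemannianMetric I M) (X Y Z : Π x : M, TangentSpace I x) (x : M) : ℝ :=
  mvfderiv I (g.onFields Y Z) x (X x) + mvfderiv I (g.onFields X Z) x (Y x)
    - mvfderiv I (g.onFields X Y) x (Z x)
    + g.inner x (VectorField.mlieBracket I X Y x) (Z x)
    - g.inner x (VectorField.mlieBracket I X Z x) (Y x)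
    - g.inner x (VectorField.mlieBracket I Y Z x) (X x)

lemma exists_extension {x : M} (v : TangentSpace I x) :
    ∃ X : Π x : M, TangentSpace I x, MDiffAt (T% X) x ∧ X x = v :=
  ⟨FiberBundle.extend E v, FiberBundle.mdifferentiableAt_extend .., by simp⟩

variable [FiniteDimensional ℝ E]

lemma koszul_tensorial_left (g : RiemannianMetric I M) {Y Z : Π x : M, TangentSpace I x} {x : M}
    (hY : MDiffAt (T% Y) x) (hZ : MDiffAt (T% Z) x) :
    TensorialAt I E (fun X => koszul g X Y Z x) x where
  smul {f X} hf hX := by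
    have e1 : g.onFields (f • X) Z = f * g.onFields X Z := by
      funext y; simp [RiemannianMetric.onFields]
    have e2 : g.onFields (f • X) Y = f * g.onFields X Y := by
      funext y; simp [RiemannianMetric.onFields]
    have hs : g.inner x (X x) (Y x) = g.onFields X Y x := rfl
    have hs' : g.inner x (X x) (Z x) = g.onFields X Z x := rfl
    simp only [koszul, e1, e2]
    rw [mvfderiv_mul hf (mdifferentiableAt_metric g hX hZ),
      mvfderiv_mul hf (mdifferentiableAt_metric g hX hY),
      VectorField.mlieBracket_smul_left hf hX, VectorField.mlieBracket_smul_left hf hX]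
    simp [hs, hs']
    ring
  add {X X'} hX hX' := by
    have e1 : ∀ W, g.onFields (X + X') W = g.onFields X W + g.onFields X' W := by
      intro W; funext y; simp [RiemannianMetric.onFields]
    simp only [koszul, e1]
    rw [mvfderiv_add (mdifferentiableAt_metric g hX hZ) (mdifferentiableAt_metric g hX' hZ),
      mvfderiv_add (mdifferentiableAt_metric g hX hY) (mdifferentiableAt_metric g hX' hY),
      VectorField.mlieBracket_add_left hX hX', VectorField.mlieBracket_add_left hX hX']
    simp
    ring

lemma koszul_tensorial_right (g : RiemannianMetric I M) {X Y : Π x : M, TangentSpace I x} {x : M}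
    (hX : MDiffAt (T% X) x) (hY : MDiffAt (T% Y) x) :
    TensorialAt I E (fun Z => koszul g X Y Z x) x where
  smul {f Z} hf hZ := by
    have e1 : g.onFields X (f • Z) = f * g.onFields X Z := by
      funext y; simp [RiemannianMetric.onFields]
    have e2 : g.onFields Y (f • Z) = f * g.onFields Y Z := by
      funext y; simp [RiemannianMetric.onFields]
    have hs : g.inner x (Z x) (Y x) = g.onFields Y Z x := g.symm x _ _
    have hs' : g.inner x (Z x) (X x) = g.onFields X Z x := g.symm x _ _
    simp only [koszul, e1, e2]
    rw [mvfderiv_mul hf (mdifferentiableAt_metric g hX hZ),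
      mvfderiv_mul hf (mdifferentiableAt_metric g hY hZ),
      VectorField.mlieBracket_smul_right hf hZ, VectorField.mlieBracket_smul_right hf hZ]
    simp [hs, hs']
    ring
  add {Z Z'} hZ hZ' := by
    have e1 : ∀ W, g.onFields W (Z + Z') = g.onFields W Z + g.onFields W Z' := by
      intro W; funext y; simp [RiemannianMetric.onFields]
    simp only [koszul, e1]
    rw [mvfderiv_add (mdifferentiableAt_metric g hX hZ) (mdifferentiableAt_metric g hX hZ'),
      mvfderiv_add (mdifferentiableAt_metric g hY hZ) (mdifferentiableAt_metric g hY hZ'),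
      VectorField.mlieBracket_add_right hZ hZ', VectorField.mlieBracket_add_right hZ hZ']
    simp
    ring

/-- For a fixed field `Y` differentiable at `x`, the Koszul expression as a bilinear form in
`(X x, Z x)`. -/
def koszulForm (g : RiemannianMetric I M) (Y : Π x : M, TangentSpace I x) (x : M)
    (hY : MDiffAt (T% Y) x) : TangentSpace I x →L[ℝ] TangentSpace I x →L[ℝ] ℝ :=
  TensorialAt.mkHom₂ (F := E) (F' := E) (fun X Z => koszul g X Y Z x) x
    (fun _ hZ => koszul_tensorial_left g hY hZ) (fun _ hX => koszul_tensorial_right g hX hY)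

/-- The musical isomorphism `v ↦ g(v, ·)` at a point. -/
def flatEquiv (g : RiemannianMetric I M) (x : M) :
    TangentSpace I x ≃ₗ[ℝ] Module.Dual ℝ (TangentSpace I x) :=
  haveI : FiniteDimensional ℝ (TangentSpace I x) := inferInstanceAs (FiniteDimensional ℝ E)
  LinearMap.linearEquivOfInjective
    (ContinuousLinearMap.coeLM ℝ ∘ₗ (g.inner x).toLinearMap)
    (by
      intro v w h
      by_contra hvw
      have h1 := g.pos x (v - w) (sub_ne_zero.2 hvw)
      have h2 := LinearMap.congr_fun h (v - w)
      simp at h1 h2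
      linarith)
    (Subspace.dual_finrank_eq).symm

lemma inner_flatEquiv_symm (g : RiemannianMetric I M) (x : M) (α : TangentSpace I x →L[ℝ] ℝ)
    (w : TangentSpace I x) :
    g.inner x ((flatEquiv g x).symm α.toLinearMap) w = α w := by
  have := LinearMap.congr_fun ((flatEquiv g x).apply_symm_apply α.toLinearMap) w
  exact this

open Classical in
/-- `leviCivitaFun g Y x v = ∇_v Y`, the solution of `2 g(∇_X Y, Z) = koszul g X Y Z` (with the
conventional value `0` if `Y` is not differentiable at `x`). -/
def leviCivitaFun (g : RiemannianMetric I M) (Y : Π x : M, TangentSpace I x) (x : M) :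
    TangentSpace I x →L[ℝ] TangentSpace I x :=
  haveI : FiniteDimensional ℝ (TangentSpace I x) := inferInstanceAs (FiniteDimensional ℝ E)
  haveI : T2Space (TangentSpace I x) := inferInstanceAs (T2Space E)
  if hY : MDiffAt (T% Y) x then
    LinearMap.toContinuousLinearMap
      ((flatEquiv g x).symm.toLinearMap ∘ₗ ContinuousLinearMap.coeLM ℝ ∘ₗ
        ((2⁻¹ : ℝ) • koszulForm g Y x hY).toLinearMap)
  else 0

lemma inner_leviCivitaFun (g : RiemannianMetric I M) {X Y Z : Π x : M, TangentSpace I x} {x : M}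
    (hX : MDiffAt (T% X) x) (hY : MDiffAt (T% Y) x) (hZ : MDiffAt (T% Z) x) :
    2 * g.inner x (leviCivitaFun g Y x (X x)) (Z x) = koszul g X Y Z x := by
  have h1 : koszulForm g Y x hY (X x) (Z x) = koszul g X Y Z x :=
    TensorialAt.mkHom₂_apply _ _ hX hZ
  rw [← h1, leviCivitaFun, dif_pos hY]
  have h2 := inner_flatEquiv_symm g x (((2⁻¹ : ℝ) • koszulForm g Y x hY) (X x)) (Z x)
  simp only [LinearMap.coe_toContinuousLinearMap', LinearMap.comp_apply]
  refine (congrArg (2 * ·) h2).trans ?_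
  simp

lemma eq_of_inner_eq (g : RiemannianMetric I M) {x : M} {v w : TangentSpace I x}
    (h : ∀ z, g.inner x v z = g.inner x w z) : v = w :=
  (flatEquiv g x).injective (LinearMap.ext h)

/-- The Levi-Civita connection of `g`: `leviCivita g Y x (X x)` is `(∇_X Y)(x)`. -/
def leviCivita (g : RiemannianMetric I M) :
    CovariantDerivative I E (TangentSpace I : M → Type _) where
  toFun := leviCivitaFun g
  isCovariantDerivativeOnUniv :=
  { add := by
      intro Y Y' x hY hY' _
      ext v
      apply eq_of_inner_eq g
      intro z
      obtain ⟨X, hX, rfl⟩ : ∃ X : Π x : M, TangentSpace I x, MDiffAt (T% X) x ∧ X x = v :=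
        exists_extension _
      obtain ⟨Z, hZ, rfl⟩ : ∃ X : Π x : M, TangentSpace I x, MDiffAt (T% X) x ∧ X x = z :=
        exists_extension _
      have a1 := inner_leviCivitaFun g hX hY hZ
      have a2 := inner_leviCivitaFun g hX hY' hZ
      have a3 := inner_leviCivitaFun g hX (mdifferentiableAt_add_section hY hY') hZ
      have e1 : ∀ W, g.onFields (Y + Y') W = g.onFields Y W + g.onFields Y' W := by
        intro W; funext y; simp [RiemannianMetric.onFields]
      have e2 : ∀ W, g.onFields W (Y + Y') = g.onFields W Y + g.onFields W Y' := by
        intro W; funext y; simp [RiemannianMetric.onFields]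
      have a4 : koszul g X (Y + Y') Z x = koszul g X Y Z x + koszul g X Y' Z x := by
        simp only [koszul, e1, e2]
        rw [mvfderiv_add (mdifferentiableAt_metric g hY hZ) (mdifferentiableAt_metric g hY' hZ),
          mvfderiv_add (mdifferentiableAt_metric g hX hY) (mdifferentiableAt_metric g hX hY'),
          VectorField.mlieBracket_add_left hY hY', VectorField.mlieBracket_add_right hY hY']
        simp
        ring
      change 2 * g.inner x (leviCivitaFun g (Y + Y') x (X x)) (Z x) = _ at a3
      simp
      change _ = koszul g X (Y + Y') Z x at a3
      linarith
    leibniz := by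
      intro Y f x hY hf _
      ext v
      apply eq_of_inner_eq g
      intro z
      obtain ⟨X, hX, rfl⟩ : ∃ X : Π x : M, TangentSpace I x, MDiffAt (T% X) x ∧ X x = v :=
        exists_extension _
      obtain ⟨Z, hZ, rfl⟩ : ∃ X : Π x : M, TangentSpace I x, MDiffAt (T% X) x ∧ X x = z :=
        exists_extension _
      have a1 := inner_leviCivitaFun g hX hY hZ
      have a3 := inner_leviCivitaFun g hX (hf.smul_section hY) hZ
      have e1 : ∀ W, g.onFields (f • Y) W = f * g.onFields Y W := by
        intro W; funext y; simp [RiemannianMetric.onFields]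
      have e2 : ∀ W, g.onFields W (f • Y) = f * g.onFields W Y := by
        intro W; funext y; simp [RiemannianMetric.onFields]
      have hs : g.onFields X Y x = g.inner x (Y x) (X x) := g.symm x _ _
      have hs' : g.onFields Y Z x = g.inner x (Y x) (Z x) := rfl
      have a4 : koszul g X (f • Y) Z x
          = f x * koszul g X Y Z x + 2 * (mvfderiv I f x (X x) * g.inner x (Y x) (Z x)) := by
        simp only [koszul, e1, e2]
        rw [mvfderiv_mul hf (mdifferentiableAt_metric g hY hZ),
          mvfderiv_mul hf (mdifferentiableAt_metric g hX hY),
          VectorField.mlieBracket_smul_left hf hY, VectorField.mlieBracket_smul_right hf hY]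
        simp [hs, hs']
        ring
      change 2 * g.inner x (leviCivitaFun g (f • Y) x (X x)) (Z x) = koszul g X (f • Y) Z x at a3
      simp
      rw [a4, ← a1] at a3
      linarith }

/-- The connection is compatible with the metric. -/
theorem leviCivita_metric (g : RiemannianMetric I M) {X Y Z : Π x : M, TangentSpace I x} {x : M}
    (hX : MDiffAt (T% X) x) (hY : MDiffAt (T% Y) x) (hZ : MDiffAt (T% Z) x) :
    mvfderiv I (g.onFields Y Z) x (X x)
      = g.inner x (leviCivita g Y x (X x)) (Z x) + g.inner x (Y x) (leviCivita g Z x (X x)) := by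
  have h1 := inner_leviCivitaFun g hX hY hZ
  have h2 := inner_leviCivitaFun g hX hZ hY
  have hs : ∀ V W, g.onFields V W = g.onFields W V := fun V W => funext fun y => g.symm y _ _
  have b : ∀ V W : Π x : M, TangentSpace I x,
      VectorField.mlieBracket I V W x = - VectorField.mlieBracket I W V x :=
    fun V W => VectorField.mlieBracket_swap_apply
  change _ = g.inner x (leviCivitaFun g Y x (X x)) (Z x)
    + g.inner x (Y x) (leviCivitaFun g Z x (X x))
  rw [g.symm x (Y x)]
  rw [koszul] at h1 h2
  rw [hs Z Y, b Z Y] at h2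
  simp at h2
  linarith

/-- The connection is torsion free. -/
theorem leviCivita_torsion (g : RiemannianMetric I M) {X Y : Π x : M, TangentSpace I x} {x : M}
    (hX : MDiffAt (T% X) x) (hY : MDiffAt (T% Y) x) :
    leviCivita g Y x (X x) - leviCivita g X x (Y x) = VectorField.mlieBracket I X Y x := by
  apply eq_of_inner_eq g
  intro z
  obtain ⟨Z, hZ, rfl⟩ : ∃ X : Π x : M, TangentSpace I x, MDiffAt (T% X) x ∧ X x = z :=
    exists_extension _
  have h1 := inner_leviCivitaFun g hX hY hZ
  have h2 := inner_leviCivitaFun g hY hX hZ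
  change g.inner x (leviCivitaFun g Y x (X x) - leviCivitaFun g X x (Y x)) (Z x) = _
  have hs : ∀ V W, g.onFields V W = g.onFields W V := fun V W => funext fun y => g.symm y _ _
  have b : ∀ V W : Π x : M, TangentSpace I x,
      VectorField.mlieBracket I V W x = - VectorField.mlieBracket I W V x :=
    fun V W => VectorField.mlieBracket_swap_apply
  rw [koszul] at h1 h2
  rw [hs Y X, b Y X] at h2
  simp at h2 ⊢
  linarith

/-- The curvature `R_{XY} Z = ∇_X ∇_Y Z - ∇_Y ∇_X Z - ∇_{[X,Y]} Z` of the Levi-Civita connection. -/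
def curvature (g : RiemannianMetric I M) (X Y Z : Π x : M, TangentSpace I x) (x : M) :
    TangentSpace I x :=
  leviCivita g (fun y => leviCivita g Z y (Y y)) x (X x)
    - leviCivita g (fun y => leviCivita g Z y (X y)) x (Y x)
    - leviCivita g Z x (VectorField.mlieBracket I X Y x)

/-- The vector field `X` is smooth at the point `x`. -/
def SmoothFieldAt (X : Π x : M, TangentSpace I x) (x : M) : Prop :=
  ContMDiffAt I I.tangent ∞ (fun y => (⟨y, X y⟩ : TangentBundle I M)) x

/-- A Riemannian metric is flat if its Riemann curvature tensor vanishes. -/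
def IsFlat (g : RiemannianMetric I M) : Prop :=
  ∀ (x : M) (X Y Z : Π x : M, TangentSpace I x),
    SmoothFieldAt X x → SmoothFieldAt Y x → SmoothFieldAt Z x → curvature g X Y Z x = 0

/-! ### Differential forms of degree one and two, endomorphism fields -/

/-- The exterior derivative of a one-form evaluated on vector fields,
`X η(Y) - Y η(X) - η([X,Y])`. -/
def dOne (η : Π x : M, TangentSpace I x →L[ℝ] ℝ) (X Y : Π x : M, TangentSpace I x) (x : M) : ℝ :=
  mvfderiv I (fun y => η y (Y y)) x (X x) - mvfderiv I (fun y => η y (X y)) x (Y x)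
    - η x (VectorField.mlieBracket I X Y x)

/-- The two-form `(v, w) ↦ g(v, T w)` attached to a metric and a (skew) endomorphism field. -/
def fundamentalForm (g : RiemannianMetric I M)
    (T : Π x : M, TangentSpace I x →L[ℝ] TangentSpace I x) (x : M) (v w : TangentSpace I x) : ℝ :=
  g.inner x v (T x w)

/-- The exterior derivative of a two-form evaluated on vector fields, the cyclic sum of
`X Ω(Y,Z) - Ω([X,Y],Z)`. -/
def dTwo (Ω : Π x : M, TangentSpace I x → TangentSpace I x → ℝ)
    (X Y Z : Π x : M, TangentSpace I x) (x : M) : ℝ :=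
  mvfderiv I (fun y => Ω y (Y y) (Z y)) x (X x)
    + mvfderiv I (fun y => Ω y (Z y) (X y)) x (Y x)
    + mvfderiv I (fun y => Ω y (X y) (Y y)) x (Z x)
    - Ω x (VectorField.mlieBracket I X Y x) (Z x)
    - Ω x (VectorField.mlieBracket I Y Z x) (X x)
    - Ω x (VectorField.mlieBracket I Z X x) (Y x)

/-- The wedge product of a one-form and a two-form at a point. -/
def wedgeOneTwo {x : M} (α : TangentSpace I x →L[ℝ] ℝ)
    (Ω : TangentSpace I x → TangentSpace I x → ℝ) (u v w : TangentSpace I x) : ℝ :=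
  α u * Ω v w + α v * Ω w u + α w * Ω u v

/-- The wedge product of two one-forms at a point. -/
def wedgeOneOne {x : M} (α β : TangentSpace I x →L[ℝ] ℝ) (v w : TangentSpace I x) : ℝ :=
  α v * β w - α w * β v

/-- Smoothness of a field of endomorphisms of the tangent bundle. -/
def SmoothEndo (T : Π x : M, TangentSpace I x →L[ℝ] TangentSpace I x) : Prop :=
  ContMDiff I (I.prod 𝓘(ℝ, E →L[ℝ] E)) ∞
    (fun x => TotalSpace.mk' (E →L[ℝ] E)
      (E := fun x : M => TangentSpace I x →L[ℝ] TangentSpace I x) x (T x))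

/-! ### Kähler structures -/

/-- `(J, G)` is a Kähler structure: a smooth almost complex structure, compatible with the metric,
with vanishing Nijenhuis torsion and closed fundamental two-form. -/
structure IsKahler (G : RiemannianMetric I M)
    (J : Π x : M, TangentSpace I x →L[ℝ] TangentSpace I x) : Prop where
  smooth : SmoothEndo J
  sq : ∀ (x : M) (v : TangentSpace I x), J x (J x v) = -v
  compatible : ∀ (x : M) (v w : TangentSpace I x), G.inner x (J x v) (J x w) = G.inner x v w
  nijenhuis : ∀ (x : M) (X Y : Π x : M, TangentSpace I x),
    SmoothFieldAt X x → SmoothFieldAt Y x →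
    VectorField.mlieBracket I (fun y => J y (X y)) (fun y => J y (Y y)) x
      - J x (VectorField.mlieBracket I (fun y => J y (X y)) Y x)
      - J x (VectorField.mlieBracket I X (fun y => J y (Y y)) x)
      - VectorField.mlieBracket I X Y x = 0
  closed : ∀ (x : M) (X Y Z : Π x : M, TangentSpace I x),
    SmoothFieldAt X x → SmoothFieldAt Y x → SmoothFieldAt Z x →
    dTwo (fundamentalForm G J) X Y Z x = 0

/-! ### Almost Kenmotsu manifolds and nullity conditions -/

variable (I M) in
/-- An almost contact metric structure `(φ, ξ, η, g)` on `M`. -/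
structure AlmostContactMetric where
  φ : Π x : M, TangentSpace I x →L[ℝ] TangentSpace I x
  ξ : Π x : M, TangentSpace I x
  η : Π x : M, TangentSpace I x →L[ℝ] ℝ
  g : RiemannianMetric I M
  smooth_φ : SmoothEndo φ
  smooth_ξ : ∀ x, SmoothFieldAt ξ x
  smooth_η : ContMDiff I (I.prod 𝓘(ℝ, E →L[ℝ] ℝ)) ∞
    (fun x => TotalSpace.mk' (E →L[ℝ] ℝ) (E := fun x : M => TangentSpace I x →L[ℝ] ℝ) x (η x))
  φ_sq : ∀ (x : M) (v : TangentSpace I x), φ x (φ x v) = -v + η x v • ξ x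
  η_ξ : ∀ x : M, η x (ξ x) = 1
  compatible : ∀ (x : M) (v w : TangentSpace I x),
    g.inner x (φ x v) (φ x w) = g.inner x v w - η x v * η x w

namespace AlmostContactMetric

/-- The almost Kenmotsu conditions `dη = 0` and `dΦ = 2 η ∧ Φ`, where `Φ(X,Y) = g(X, φY)`. -/
structure IsAlmostKenmotsu (S : AlmostContactMetric I M) : Prop where
  closed : ∀ (x : M) (X Y : Π x : M, TangentSpace I x),
    SmoothFieldAt X x → SmoothFieldAt Y x → dOne S.η X Y x = 0
  dΦ : ∀ (x : M) (X Y Z : Π x : M, TangentSpace I x),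
    SmoothFieldAt X x → SmoothFieldAt Y x → SmoothFieldAt Z x →
    dTwo (fundamentalForm S.g S.φ) X Y Z x
      = 2 * wedgeOneTwo (S.η x) (fundamentalForm S.g S.φ x) (X x) (Y x) (Z x)

/-- `h = (1/2) L_ξ φ`, that is `h X = (1/2) ([ξ, φX] - φ[ξ, X])`. -/
def h (S : AlmostContactMetric I M) (X : Π x : M, TangentSpace I x) (x : M) : TangentSpace I x :=
  (1 / 2 : ℝ) • (VectorField.mlieBracket I S.ξ (fun y => S.φ y (X y)) x
    - S.φ x (VectorField.mlieBracket I S.ξ X x))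

/-- `h'` is the composition of `h` with `φ` (first `φ`, then `h`). -/
def h' (S : AlmostContactMetric I M) (X : Π x : M, TangentSpace I x) (x : M) : TangentSpace I x :=
  S.h (fun y => S.φ y (X y)) x

/-- The generalized `(k, μ)`-nullity condition
`R_{XY} ξ = k (η(Y) X - η(X) Y) + μ (η(Y) hX - η(X) hY)`, with `k`, `μ` smooth functions. -/
structure IsGeneralizedKMu (S : AlmostContactMetric I M) (k μ : M → ℝ) : Prop where
  smooth_k : ContMDiff I 𝓘(ℝ, ℝ) ∞ k
  smooth_μ : ContMDiff I 𝓘(ℝ, ℝ) ∞ μ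
  nullity : ∀ (x : M) (X Y : Π x : M, TangentSpace I x),
    SmoothFieldAt X x → SmoothFieldAt Y x →
    curvature S.g X Y S.ξ x
      = k x • (S.η x (Y x) • X x - S.η x (X x) • Y x)
        + μ x • (S.η x (Y x) • S.h X x - S.η x (X x) • S.h Y x)

/-- The generalized `(k, μ)'`-nullity condition: the same with `h'` in place of `h`. -/
structure IsGeneralizedKMu' (S : AlmostContactMetric I M) (k μ : M → ℝ) : Prop where
  smooth_k : ContMDiff I 𝓘(ℝ, ℝ) ∞ k
  smooth_μ : ContMDiff I 𝓘(ℝ, ℝ) ∞ μ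
  nullity : ∀ (x : M) (X Y : Π x : M, TangentSpace I x),
    SmoothFieldAt X x → SmoothFieldAt Y x →
    curvature S.g X Y S.ξ x
      = k x • (S.η x (Y x) • X x - S.η x (X x) • Y x)
        + μ x • (S.η x (Y x) • S.h' X x - S.η x (X x) • S.h' Y x)

/-! ### Leaves of the canonical foliation and the induced structure -/

section Leaves

variable {E₁ : Type*} [NormedAddCommGroup E₁] [NormedSpace ℝ E₁]
  {H₁ : Type*} [TopologicalSpace H₁] {I₁ : ModelWithCorners ℝ E₁ H₁}

/-- A connected integral manifold of the canonical distribution `ker η`: a connected manifold `N`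
with an injective smooth immersion `i : N → M` whose tangent spaces are the planes `ker η`. -/
structure IsIntegralManifold (S : AlmostContactMetric I M) (I₁ : ModelWithCorners ℝ E₁ H₁)
    {N : Type*} [TopologicalSpace N] [ChartedSpace H₁ N] (i : N → M) : Prop where
  connected : ConnectedSpace N
  injective : Function.Injective i
  smooth : ContMDiff I₁ I ∞ i
  immersion : ∀ q : N, Function.Injective (mfderiv I₁ I i q)
  tangent : ∀ q : N, Set.range (mfderiv I₁ I i q) = {v | S.η (i q) v = 0}

/-- A leaf of the canonical foliation: a maximal connected integral manifold of `ker η`. -/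
structure IsLeaf.{w} (S : AlmostContactMetric I M) (I₁ : ModelWithCorners ℝ E₁ H₁)
    {N : Type w} [TopologicalSpace N] [ChartedSpace H₁ N] (i : N → M) : Prop
    extends IsIntegralManifold S I₁ i where
  maximal : ∀ (P : Type w) [TopologicalSpace P] [ChartedSpace H₁ P] [IsManifold I₁ ∞ P]
    (j : P → M), IsIntegralManifold S I₁ j → (Set.range j ∩ Set.range i).Nonempty →
    Set.range j ⊆ Set.range i

/-- `(J, G)` is the structure induced on `N` by `(φ, g)` through `i`: `G = i^* g` and
`di ∘ J = φ ∘ di`. -/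
structure IsInduced (S : AlmostContactMetric I M) {N : Type*} [TopologicalSpace N]
    [ChartedSpace H₁ N] [IsManifold I₁ ∞ N] (i : N → M) (G : RiemannianMetric I₁ N)
    (J : Π q : N, TangentSpace I₁ q →L[ℝ] TangentSpace I₁ q) : Prop where
  metric : ∀ (q : N) (v w : TangentSpace I₁ q),
    G.inner q v w = S.g.inner (i q) (mfderiv I₁ I i q v) (mfderiv I₁ I i q w)
  endo : ∀ (q : N) (v : TangentSpace I₁ q),
    mfderiv I₁ I i q (J q v) = S.φ (i q) (mfderiv I₁ I i q v)

end Leaves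

end AlmostContactMetric

end AlmostKenmotsu

end

set_option linter.unusedSectionVars false

noncomputable section
open Filter Topology
namespace AlmostKenmotsu
variable {E : Type*} [NormedAddCommGroup E] [NormedSpace ℝ E]
  {H : Type*} [TopologicalSpace H] {I : ModelWithCorners ℝ E H}
  {M : Type*} [TopologicalSpace M] [ChartedSpace H M] [IsManifold I ∞ M]

/-! ### Smooth vector fields -/

/-! Write A for ∇ξ. Closedness of η makes A symmetric with Aξ = 0, so A acts on ker η; evaluating dΦ
= 2η∧Φ on ξ, e, φe shows that its trace there is 2 (`trace_A`). The sum of g(R(X,ξ)ξ, X) over X = e,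
φe can be computed in two ways. By nullity it is 2k, since h and h' are trace free and the μ-terms
cancel. By the definition of curvature it is -|A|², since the trace is constant and ∇_ξ only rotates
the frame. Hence |A|² = -2k (`sq_A`), and the eigenvalues of A on ker η are 1 ± l with l = √(-1-k).
As k < -1 they are distinct, so a smooth local unit eigenfield V exists (`exists_eigenframeNear`).

For X, Y in ker η both nullity conditions reduce to R_{XY}ξ = 0, a Codazzi equation for A. Since
dk∧η = 0, l has zero derivative along ker η, and the Codazzi equation for V, φV leaves 2l times the
horizontal components of [V, φV]. The ξ-component vanishes because A is diagonal in this frame. So V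
and φV commute (`EigenframeNear.mlieBracket_eq_zero`).

On an integral surface V and φV restrict to an orthonormal commuting frame (e, Je). Such a frame is
parallel, so the curvature vanishes and J is parallel; as the connection has no torsion, the
Nijenhuis tensor and the differential of the fundamental form vanish too
(`isKahler_and_isFlat_of_commutingFrame`). -/

lemma SmoothFieldAt.mdifferentiableAt {X : Π x : M, TangentSpace I x} {x : M}
    (hX : SmoothFieldAt X x) : MDiffAt (T% X) x :=
  ContMDiffAt.mdifferentiableAt hX (by simp)

lemma SmoothFieldAt.eventually_mdifferentiableAt {X : Π x : M, TangentSpace I x} {x : M}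
    (hX : SmoothFieldAt X x) : ∀ᶠ y in 𝓝 x, MDiffAt (T% X) y := by
  have h1 : ContMDiffAt I I.tangent 1 (fun y => (⟨y, X y⟩ : TangentBundle I M)) x :=
    ContMDiffAt.of_le hX (by simp)
  filter_upwards [(contMDiffAt_iff_contMDiffAt_nhds (by simp)).1 h1] with y hy
  exact hy.mdifferentiableAt (by simp)

lemma SmoothFieldAt.congr {X Y : Π x : M, TangentSpace I x} {x : M}
    (hX : SmoothFieldAt X x) (h : ∀ᶠ y in 𝓝 x, Y y = X y) : SmoothFieldAt Y x :=
  ContMDiffAt.congr_of_eventuallyEq hX (h.mono fun y hy => by simp [hy])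

lemma SmoothFieldAt.add {X Y : Π x : M, TangentSpace I x} {x : M}
    (hX : SmoothFieldAt X x) (hY : SmoothFieldAt Y x) : SmoothFieldAt (fun y => X y + Y y) x :=
  ContMDiffAt.add_section hX hY

lemma SmoothFieldAt.sub {X Y : Π x : M, TangentSpace I x} {x : M}
    (hX : SmoothFieldAt X x) (hY : SmoothFieldAt Y x) : SmoothFieldAt (fun y => X y - Y y) x :=
  ContMDiffAt.sub_section hX hY

lemma SmoothFieldAt.smul {f : M → ℝ} {X : Π x : M, TangentSpace I x} {x : M}
    (hf : ContMDiffAt I 𝓘(ℝ, ℝ) ∞ f x) (hX : SmoothFieldAt X x) :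
    SmoothFieldAt (fun y => f y • X y) x :=
  ContMDiffAt.smul_section hf hX

lemma SmoothFieldAt.apply_endo {T : Π x : M, TangentSpace I x →L[ℝ] TangentSpace I x}
    (hT : SmoothEndo T) {X : Π x : M, TangentSpace I x} {x : M} (hX : SmoothFieldAt X x) :
    SmoothFieldAt (fun y => T y (X y)) x :=
  ContMDiffAt.clm_bundle_apply (F₁ := E) (F₂ := E) (b := fun m : M => m) (hT x) hX

lemma contMDiffAt_metric (g : RiemannianMetric I M) {X Y : Π x : M, TangentSpace I x} {x : M}
    (hX : SmoothFieldAt X x) (hY : SmoothFieldAt Y x) :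
    ContMDiffAt I 𝓘(ℝ, ℝ) ∞ (g.onFields X Y) x := by
  have h : ContMDiffAt I (I.prod 𝓘(ℝ, ℝ)) ∞
      (fun m ↦ TotalSpace.mk' ℝ (E := Bundle.Trivial M ℝ) m (g.inner m (X m) (Y m))) x :=
    ContMDiffAt.clm_bundle_apply₂ (F₁ := E) (F₂ := E) (b := fun m => m) (g.contMDiff x) hX hY
  simp only [contMDiffAt_totalSpace] at h
  exact h.2

/-- Smoothness on a neighbourhood, not just at the point, is what allows the extension to be
projected, normalised and differentiated repeatedly. -/
lemma exists_smooth_extension {x : M} (v : TangentSpace I x) :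
    ∃ X : Π x : M, TangentSpace I x, (∀ᶠ y in 𝓝 x, SmoothFieldAt X y) ∧ X x = v := by
  obtain ⟨s, hs, h⟩ := FiberBundle.exists_contMDiffOn_extend (k := ∞) I E v
  refine ⟨FiberBundle.extend E v, ?_, by simp⟩
  filter_upwards [eventually_mem_nhds_iff.2 hs] with y hy
  exact h.contMDiffAt hy

/-- The differential of a smooth map applied to a smooth vector field is a smooth field along the
map. -/
lemma contMDiffAt_mfderiv_field {E' : Type*} [NormedAddCommGroup E'] [NormedSpace ℝ E']
    {H' : Type*} [TopologicalSpace H'] {I' : ModelWithCorners ℝ E' H'}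
    {M' : Type*} [TopologicalSpace M'] [ChartedSpace H' M'] [IsManifold I' ∞ M']
    {f : M → M'} {X : Π x : M, TangentSpace I x} {x : M}
    (hf : ContMDiffAt I I' ∞ f x) (hX : SmoothFieldAt X x) :
    ContMDiffAt I I'.tangent ∞
      (fun y => (⟨f y, mfderiv I I' f y (X y)⟩ : TangentBundle I' M')) x :=
  ContMDiffAt.clm_apply_of_inCoordinates (b₁ := id) (b₂ := f)
    (hf.mfderiv_const (m := ∞) (by simp)) hX hf

lemma contMDiffAt_mvfderiv_field {F : Type*} [NormedAddCommGroup F] [NormedSpace ℝ F]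
    {f : M → F} {X : Π x : M, TangentSpace I x} {x : M}
    (hf : ContMDiffAt I 𝓘(ℝ, F) ∞ f x) (hX : SmoothFieldAt X x) :
    ContMDiffAt I 𝓘(ℝ, F) ∞ (fun y => mvfderiv I f y (X y)) x := by
  have h := contMDiffAt_mfderiv_field hf hX
  rw [contMDiffAt_totalSpace] at h
  refine h.2.congr_of_eventuallyEq (Eventually.of_forall fun y => ?_)
  simp [mvfderiv]
  rfl

lemma SmoothFieldAt.mlieBracket [CompleteSpace E] {X Y : Π x : M, TangentSpace I x} {x : M}
    (hX : SmoothFieldAt X x) (hY : SmoothFieldAt Y x) :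
    SmoothFieldAt (VectorField.mlieBracket I X Y) x := by
  have : IsManifold I (minSmoothness ℝ 2) M := by
    rw [minSmoothness_of_isRCLikeNormedField]
    exact IsManifold.of_le (n := ∞) ENat.LEInfty.out
  have : IsManifold I ((⊤ : ℕ∞) + 1) M := inferInstanceAs (IsManifold I ∞ M)
  exact ContMDiffAt.mlieBracket_vectorField (m := ⊤) (n := ⊤) hX hY (by simp)

/-! ### Directional derivatives and the Lie bracket -/

omit [IsManifold I ∞ M] in
lemma mvfderiv_congr {F : Type*} [NormedAddCommGroup F] [NormedSpace ℝ F]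
    {f f' : M → F} {x : M} (h : ∀ᶠ y in 𝓝 x, f y = f' y) : mvfderiv I f x = mvfderiv I f' x := by
  have h1 : f x = f' x := h.self_of_nhds
  ext v
  simp only [mvfderiv]
  have := EventuallyEq.mfderiv_eq (I := I) (I' := 𝓘(ℝ, F)) h
  exact congrArg (fun T => T v) this

omit [IsManifold I ∞ M] in
-- The pullback applies the inverse of the differential of the inverse chart, and the chain rule
-- applies that differential again; the two cancel. This transfers derivatives along fields to the
-- model space.
lemma mvfderiv_extChartAt_symm [IsManifold I 1 M] [I.Boundaryless] {F : Type*}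
    [NormedAddCommGroup F] [NormedSpace ℝ F]
    {f : M → F} (V : Π x : M, TangentSpace I x) (x : M) {z : E} (hz : z ∈ (extChartAt I x).target)
    (hf : MDiffAt f ((extChartAt I x).symm z)) :
    fderiv ℝ (f ∘ (extChartAt I x).symm) z
        (VectorField.mpullbackWithin 𝓘(ℝ, E) I (extChartAt I x).symm V (Set.range I) z)
      = mvfderiv I f ((extChartAt I x).symm z) (V ((extChartAt I x).symm z)) := by
  have h1 := isInvertible_mfderivWithin_extChartAt_symm hz
  have h2 := mdifferentiableWithinAt_extChartAt_symm (I := I) hz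
  rw [VectorField.mpullbackWithin_apply]
  simp only [I.range_eq_univ, mfderivWithin_univ, mdifferentiableWithinAt_univ] at h1 h2 ⊢
  rw [← mfderiv_eq_fderiv, mfderiv_comp z hf h2]
  have h3 : mfderiv 𝓘(ℝ, E) I (extChartAt I x).symm z
      ((mfderiv 𝓘(ℝ, E) I (extChartAt I x).symm z).inverse (V ((extChartAt I x).symm z)))
      = V ((extChartAt I x).symm z) := h1.self_apply_inverse _
  exact congrArg (mfderiv I 𝓘(ℝ, F) f ((extChartAt I x).symm z)) h3

/-- The Lie bracket acts on functions as the commutator of derivations. -/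
lemma mvfderiv_mlieBracket [I.Boundaryless] [CompleteSpace E] {F : Type*} [NormedAddCommGroup F]
    [NormedSpace ℝ F] {f : M → F} {X Y : Π x : M, TangentSpace I x} {x : M}
    (hf : ContMDiffAt I 𝓘(ℝ, F) ∞ f x) (hX : SmoothFieldAt X x) (hY : SmoothFieldAt Y x) :
    mvfderiv I f x (VectorField.mlieBracket I X Y x)
      = mvfderiv I (fun y => mvfderiv I f y (Y y)) x (X x)
        - mvfderiv I (fun y => mvfderiv I f y (X y)) x (Y x) := by
  have : IsManifold I 1 M := IsManifold.of_le (n := ∞) (by simp)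
  have h2 : (2 : ℕ∞ω) ≤ ∞ := ENat.LEInfty.out
  have : IsManifold I 2 M := IsManifold.of_le h2
  have hxt := mem_extChartAt_target (I := I) x
  have hfd : ∀ᶠ y in 𝓝 x, MDiffAt f y := by
    have h1 : ContMDiffAt I 𝓘(ℝ, F) 1 f x := hf.of_le (by simp)
    filter_upwards [(contMDiffAt_iff_contMDiffAt_nhds (by simp)).1 h1] with y hy
    exact hy.mdifferentiableAt (by simp)
  have hcont : Tendsto (extChartAt I x).symm (𝓝 (extChartAt I x x)) (𝓝 x) := by
    have := (continuousAt_extChartAt_symm (I := I) x).tendsto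
    rwa [extChartAt_to_inv] at this
  have hev : ∀ V : Π x : M, TangentSpace I x, ∀ᶠ z in 𝓝 (extChartAt I x x),
      fderiv ℝ (f ∘ (extChartAt I x).symm) z
        (VectorField.mpullbackWithin 𝓘(ℝ, E) I (extChartAt I x).symm V (Set.range I) z)
      = ((fun y => mvfderiv I f y (V y)) ∘ (extChartAt I x).symm) z := by
    intro V
    filter_upwards [extChartAt_target_mem_nhds (I := I) x, hcont.eventually hfd] with z hz hz'
    exact mvfderiv_extChartAt_symm V x hz hz'
  have hpt : ∀ (h : M → F) (V : Π x : M, TangentSpace I x), MDiffAt h x →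
      fderiv ℝ (h ∘ (extChartAt I x).symm) (extChartAt I x x)
        (VectorField.mpullbackWithin 𝓘(ℝ, E) I (extChartAt I x).symm V (Set.range I)
          (extChartAt I x x))
      = mvfderiv I h x (V x) := by
    intro h V hh
    have h1 := extChartAt_to_inv (I := I) x
    have := mvfderiv_extChartAt_symm (f := h) V x hxt (by rwa [h1])
    exact this.trans (congrArg (fun p => mvfderiv I h p (V p)) h1)
  have hFd : ContDiffAt ℝ 2 (f ∘ (extChartAt I x).symm) (extChartAt I x x) := by
    rw [← contMDiffAt_iff_contDiffAt]
    have h3 := contMDiffWithinAt_extChartAt_symm_range_self (I := I) (n := 2) x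
    rw [I.range_eq_univ, contMDiffWithinAt_univ] at h3
    exact ContMDiffAt.comp _ (by rw [extChartAt_to_inv]; exact hf.of_le h2) h3
  have hdiff : ∀ V : Π x : M, TangentSpace I x, SmoothFieldAt V x → DifferentiableAt ℝ
      (VectorField.mpullbackWithin 𝓘(ℝ, E) I (extChartAt I x).symm V (Set.range I))
      (extChartAt I x x) := by
    intro V hV
    have := MDifferentiableWithinAt.differentiableWithinAt_mpullbackWithin_vectorField (s := Set.univ)
      (mdifferentiableWithinAt_univ.2 hV.mdifferentiableAt)
    rw [I.range_eq_univ, Set.preimage_univ, Set.univ_inter] at this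
    rw [I.range_eq_univ]
    exact differentiableWithinAt_univ.1 this
  have hV1 : ∀ V : Π x : M, TangentSpace I x, SmoothFieldAt V x →
      MDiffAt (fun y => mvfderiv I f y (V y)) x := fun V hV =>
    (contMDiffAt_mvfderiv_field hf hV).mdifferentiableAt (by simp)
  -- In the chart this is the symmetry of the second derivative, hence the C² hypothesis `hFd`.
  have key := VectorField.fderiv_apply_lieBracket (𝕜 := ℝ) hFd (by simp) (hdiff Y hY) (hdiff X hX)
  rw [EventuallyEq.fderiv_eq (hev Y), EventuallyEq.fderiv_eq (hev X), hpt _ X (hV1 Y hY),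
    hpt _ Y (hV1 X hX)] at key
  rw [← key, ← hpt f (VectorField.mlieBracket I X Y) (hf.mdifferentiableAt (by simp))]
  -- At the base point the chart and its inverse have identity differential in the tangent
  -- coordinates, so pulled-back vectors are unchanged there.
  have hsymm : ∀ V : Π x : M, TangentSpace I x,
      VectorField.mpullbackWithin 𝓘(ℝ, E) I (extChartAt I x).symm V (Set.range I)
        (extChartAt I x x) = V ((extChartAt I x).symm (extChartAt I x x)) := by
    intro V
    rw [VectorField.mpullbackWithin_apply, mfderivWithin_range_extChartAt_symm]
    exact congrArg (fun T : E →L[ℝ] E => T _) ContinuousLinearMap.inverse_id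
  have hb := VectorField.mlieBracketWithin_apply (I := I) (V := X) (W := Y) (s := Set.univ) (x₀ := x)
  rw [mfderiv_extChartAt_self, I.range_eq_univ, Set.preimage_univ, Set.univ_inter,
    VectorField.mlieBracketWithin_univ] at hb
  have hb' := hb.trans (congrArg (fun T : E →L[ℝ] E => T _) ContinuousLinearMap.inverse_id)
  rw [hsymm, I.range_eq_univ]
  refine congrArg (fderiv ℝ (f ∘ (extChartAt I x).symm) (extChartAt I x x)) ?_
  refine Eq.trans ?_ (hb'.trans (congrFun (VectorField.lieBracketWithin_univ (𝕜 := ℝ) (E := E)) _))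
  exact congrArg (fun p => (VectorField.mlieBracket I X Y p : E)) (extChartAt_to_inv (I := I) x)

/-! ### Smoothness, locality and Leibniz rule of the Levi-Civita connection -/

variable [FiniteDimensional ℝ E]

lemma contMDiffAt_koszul (g : RiemannianMetric I M) {X Y Z : Π x : M, TangentSpace I x} {x : M}
    (hX : SmoothFieldAt X x) (hY : SmoothFieldAt Y x) (hZ : SmoothFieldAt Z x) :
    ContMDiffAt I 𝓘(ℝ, ℝ) ∞ (koszul g X Y Z) x := by
  have : CompleteSpace E := FiniteDimensional.complete ℝ E
  exact (((((contMDiffAt_mvfderiv_field (contMDiffAt_metric g hY hZ) hX).add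
    (contMDiffAt_mvfderiv_field (contMDiffAt_metric g hX hZ) hY)).sub
    (contMDiffAt_mvfderiv_field (contMDiffAt_metric g hX hY) hZ)).add
    (contMDiffAt_metric g (hX.mlieBracket hY) hZ)).sub
    (contMDiffAt_metric g (hX.mlieBracket hZ) hY)).sub
    (contMDiffAt_metric g (hY.mlieBracket hZ) hX)

lemma contMDiffAt_inner_leviCivita (g : RiemannianMetric I M) {X Y Z : Π x : M, TangentSpace I x}
    {x : M} (hX : SmoothFieldAt X x) (hY : SmoothFieldAt Y x) (hZ : SmoothFieldAt Z x) :
    ContMDiffAt I 𝓘(ℝ, ℝ) ∞ (fun y => g.inner y (leviCivita g Y y (X y)) (Z y)) x := by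
  refine ((contMDiffAt_const (c := (1 / 2 : ℝ))).mul (contMDiffAt_koszul g hX hY hZ)).congr_of_eventuallyEq ?_
  filter_upwards [hX.eventually_mdifferentiableAt, hY.eventually_mdifferentiableAt,
    hZ.eventually_mdifferentiableAt] with y h1 h2 h3
  have : 2 * g.inner y (leviCivita g Y y (X y)) (Z y) = koszul g X Y Z y :=
    inner_leviCivitaFun g h1 h2 h3
  simp only [Pi.mul_apply]
  linarith

lemma leviCivita_congr (g : RiemannianMetric I M) {Y Y' : Π x : M, TangentSpace I x} {x : M}
    (hY : MDiffAt (T% Y) x) (h : ∀ᶠ y in 𝓝 x, Y' y = Y y) :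
    leviCivita g Y' x = leviCivita g Y x := by
  refine (leviCivita g).isCovariantDerivativeOn.congr_of_eventuallyEq (s := Set.univ) ?_ hY
    univ_mem h
  exact MDifferentiableAt.congr_of_eventuallyEq hY (h.mono fun y hy => by simp [hy])

lemma leviCivita_add (g : RiemannianMetric I M) {Y Y' : Π x : M, TangentSpace I x} {x : M}
    (hY : MDiffAt (T% Y) x) (hY' : MDiffAt (T% Y') x) (v : TangentSpace I x) :
    leviCivita g (fun y => Y y + Y' y) x v = leviCivita g Y x v + leviCivita g Y' x v := by
  have := (leviCivita g).isCovariantDerivativeOnUniv.add hY hY' trivial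
  exact congrArg (fun T => T v) this

lemma leviCivita_smul (g : RiemannianMetric I M) {f : M → ℝ} {Y : Π x : M, TangentSpace I x} {x : M}
    (hf : MDiffAt f x) (hY : MDiffAt (T% Y) x) (v : TangentSpace I x) :
    leviCivita g (fun y => f y • Y y) x v
      = mvfderiv I f x v • Y x + f x • leviCivita g Y x v := by
  have := (leviCivita g).isCovariantDerivativeOnUniv.leibniz hY hf trivial
  refine (congrArg (fun T => T v) this).trans ?_
  simp [add_comm]

end AlmostKenmotsu

end

noncomputable section
open Filter Topology
namespace AlmostKenmotsu
variable {E : Type*} [NormedAddCommGroup E] [NormedSpace ℝ E]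
  {H : Type*} [TopologicalSpace H] {I : ModelWithCorners ℝ E H}
  {M : Type*} [TopologicalSpace M] [ChartedSpace H M] [IsManifold I ∞ M]
  [FiniteDimensional ℝ E]

/-! ### Orthonormal frames -/

/-- The coordinate map v ↦ (g(uᵢ, v))ᵢ is onto by orthonormality, hence injective by equality of
dimensions; both sides have the same coordinates. -/
lemma eq_sum_of_orthonormal (g : RiemannianMetric I M) {n : ℕ}
    (hn : Module.finrank ℝ E = n)
    {x : M} {u : Fin n → TangentSpace I x}
    (hu : ∀ i j, g.inner x (u i) (u j) = if i = j then 1 else 0) (v : TangentSpace I x) :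
    v = ∑ i, g.inner x v (u i) • u i := by
  have : FiniteDimensional ℝ (TangentSpace I x) := inferInstanceAs (FiniteDimensional ℝ E)
  let f : TangentSpace I x →ₗ[ℝ] (Fin n → ℝ) :=
    LinearMap.pi fun i => ((g.inner x (u i)) : TangentSpace I x →L[ℝ] ℝ).toLinearMap
  have hf : ∀ c : Fin n → ℝ, f (∑ i, c i • u i) = c := by
    intro c
    funext j
    simp [f, hu]
  have hs : Function.Surjective f := fun c => ⟨_, hf c⟩
  have hd : Module.finrank ℝ (TangentSpace I x) = Module.finrank ℝ (Fin n → ℝ) := by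
    rw [Module.finrank_fin_fun]
    exact hn
  refine (LinearMap.injective_iff_surjective_of_finrank_eq_finrank hd).2 hs ?_
  rw [hf]
  funext j
  exact g.symm x _ _

/-- The fields `u i` are smooth near `x` and form an orthonormal frame near `x`. -/
structure IsOrthonormalFrameNear (g : RiemannianMetric I M) {n : ℕ}
    (u : Fin n → Π x : M, TangentSpace I x) (x : M) : Prop where
  smooth : ∀ᶠ y in 𝓝 x, ∀ i, SmoothFieldAt (u i) y
  orthonormal : ∀ᶠ y in 𝓝 x, ∀ i j, g.inner y (u i y) (u j y) = if i = j then 1 else 0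

lemma smoothFieldAt_sum {n : ℕ} {f : Fin n → M → ℝ} {u : Fin n → Π x : M, TangentSpace I x} {x : M}
    (hf : ∀ i, ContMDiffAt I 𝓘(ℝ, ℝ) ∞ (f i) x) (hu : ∀ i, SmoothFieldAt (u i) x) :
    SmoothFieldAt (fun y => ∑ i, f i y • u i y) x :=
  ContMDiffAt.sum_section fun i _ => SmoothFieldAt.smul (hf i) (hu i)

/-- The Koszul formula only controls inner products with ∇_X Y; expanding in a smooth orthonormal
frame turns this into smoothness of the field itself. -/
lemma IsOrthonormalFrameNear.smoothFieldAt {g : RiemannianMetric I M} {n : ℕ}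
    (hn : Module.finrank ℝ E = n) {u : Fin n → Π x : M, TangentSpace I x} {x : M}
    (hu : IsOrthonormalFrameNear g u x) {W : Π x : M, TangentSpace I x}
    (hW : ∀ i, ContMDiffAt I 𝓘(ℝ, ℝ) ∞ (fun y => g.inner y (W y) (u i y)) x) :
    SmoothFieldAt W x := by
  refine (smoothFieldAt_sum hW hu.smooth.self_of_nhds).congr ?_
  filter_upwards [hu.orthonormal] with y hy
  exact eq_sum_of_orthonormal g hn hy (W y)

lemma IsOrthonormalFrameNear.smoothFieldAt_leviCivita {g : RiemannianMetric I M} {n : ℕ}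
    (hn : Module.finrank ℝ E = n) {u : Fin n → Π x : M, TangentSpace I x} {x : M}
    (hu : IsOrthonormalFrameNear g u x) {X Y : Π x : M, TangentSpace I x}
    (hX : SmoothFieldAt X x) (hY : SmoothFieldAt Y x) :
    SmoothFieldAt (fun y => leviCivita g Y y (X y)) x :=
  hu.smoothFieldAt hn fun i => contMDiffAt_inner_leviCivita g hX hY (hu.smooth.self_of_nhds i)

lemma contMDiffAt_sqrt {f : M → ℝ} {x : M} (hf : ContMDiffAt I 𝓘(ℝ, ℝ) ∞ f x) (h : 0 < f x) :
    ContMDiffAt I 𝓘(ℝ, ℝ) ∞ (fun y => √(f y)) x :=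
  (Real.contDiffAt_sqrt h.ne').contMDiffAt.comp x hf

lemma contMDiffAt_inv_sqrt {f : M → ℝ} {x : M} (hf : ContMDiffAt I 𝓘(ℝ, ℝ) ∞ f x) (h : 0 < f x) :
    ContMDiffAt I 𝓘(ℝ, ℝ) ∞ (fun y => (√(f y))⁻¹) x :=
  (contDiffAt_inv ℝ (Real.sqrt_pos.2 h).ne').contMDiffAt.comp x (contMDiffAt_sqrt hf h)

omit [FiniteDimensional ℝ E] in
lemma inner_normalize (g : RiemannianMetric I M) {x : M} {v : TangentSpace I x}
    (hv : 0 < g.inner x v v) :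
    g.inner x ((√(g.inner x v v))⁻¹ • v) ((√(g.inner x v v))⁻¹ • v) = 1 := by
  have := Real.mul_self_sqrt hv.le
  have h2 := (Real.sqrt_pos.2 hv).ne'
  simp only [map_smul, smul_apply, smul_eq_mul]
  field_simp
  nlinarith

/-- Metric compatibility applied to a constant inner product: the source of all skew-symmetry
relations between connection coefficients of orthonormal frames. -/
lemma mvfderiv_inner_const (g : RiemannianMetric I M) {Y Z : Π x : M, TangentSpace I x} {x : M}
    (hY : SmoothFieldAt Y x) (hZ : SmoothFieldAt Z x) {c : ℝ}
    (h : ∀ᶠ y in 𝓝 x, g.inner y (Y y) (Z y) = c) (v : TangentSpace I x) :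
    g.inner x (leviCivita g Y x v) (Z x) + g.inner x (leviCivita g Z x v) (Y x) = 0 := by
  obtain ⟨X, hX, rfl⟩ := exists_extension v
  have h1 := leviCivita_metric g hX hY.mdifferentiableAt hZ.mdifferentiableAt
  have h2 : mvfderiv I (g.onFields Y Z) x = mvfderiv I (fun _ : M => c) x := mvfderiv_congr h
  rw [h2, mvfderiv_const, g.symm x (Y x)] at h1
  simpa using h1.symm

/-! ### Pointwise algebra of an almost contact metric structure -/

namespace AlmostContactMetric

variable (S : AlmostContactMetric I M)

lemma ξ_ne_zero (x : M) : S.ξ x ≠ 0 := by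
  intro h
  have := S.η_ξ x
  rw [h, map_zero] at this
  exact zero_ne_one this

lemma φ_ξ (x : M) : S.φ x (S.ξ x) = 0 := by
  have h1 : S.φ x (S.φ x (S.ξ x)) = 0 := by rw [S.φ_sq, S.η_ξ]; simp
  have h2 := S.φ_sq x (S.φ x (S.ξ x))
  rw [h1, map_zero] at h2
  have h3 : S.φ x (S.ξ x) = S.η x (S.φ x (S.ξ x)) • S.ξ x := by
    have := h2.symm
    rwa [neg_add_eq_zero] at this
  rw [h3, map_smul] at h1
  have h4 : S.η x (S.φ x (S.ξ x)) = 0 := by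
    by_contra h
    have h5 := (smul_eq_zero.1 h1).resolve_left h
    rw [h5, map_zero] at h
    exact h rfl
  rw [h3, h4, zero_smul]

lemma inner_ξ (x : M) (v : TangentSpace I x) : S.g.inner x v (S.ξ x) = S.η x v := by
  have h := S.compatible x v (S.ξ x)
  rw [S.φ_ξ, S.η_ξ] at h
  simp at h
  linarith

lemma inner_ξ_left (x : M) (v : TangentSpace I x) : S.g.inner x (S.ξ x) v = S.η x v := by
  rw [S.g.symm, S.inner_ξ]

lemma η_φ (x : M) (v : TangentSpace I x) : S.η x (S.φ x v) = 0 := by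
  have h1 := S.φ_sq x (S.φ x v)
  rw [S.φ_sq x v, map_add, map_neg, map_smul, S.φ_ξ, smul_zero, add_zero] at h1
  have h2 : S.η x (S.φ x v) • S.ξ x = 0 := by
    have := h1.symm
    simpa using this
  exact (smul_eq_zero.1 h2).resolve_right (S.ξ_ne_zero x)

lemma inner_φ_left (x : M) (v w : TangentSpace I x) :
    S.g.inner x (S.φ x v) w = - S.g.inner x v (S.φ x w) := by
  have h := S.compatible x (S.φ x v) w
  rw [S.φ_sq, S.η_φ] at h
  simp [S.inner_ξ_left, S.η_φ] at h
  linarith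

lemma inner_φ_self (x : M) (v : TangentSpace I x) : S.g.inner x v (S.φ x v) = 0 := by
  have h := S.inner_φ_left x v v
  rw [S.g.symm] at h
  linarith

lemma φ_φ {x : M} {v : TangentSpace I x} (hv : S.η x v = 0) : S.φ x (S.φ x v) = -v := by
  rw [S.φ_sq, hv]; simp

lemma contMDiffAt_η {X : Π x : M, TangentSpace I x} {x : M} (hX : SmoothFieldAt X x) :
    ContMDiffAt I 𝓘(ℝ, ℝ) ∞ (fun y => S.η y (X y)) x := by
  have := contMDiffAt_metric S.g hX (S.smooth_ξ x)
  refine this.congr_of_eventuallyEq (Eventually.of_forall fun y => (S.inner_ξ y _).symm)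

/-! ### The endomorphism `∇ξ` -/

/-- `A v = ∇_v ξ`. -/
def A (x : M) : TangentSpace I x →L[ℝ] TangentSpace I x := leviCivita S.g S.ξ x

/-- ξ has constant length 1, so its covariant derivatives are orthogonal to it. -/
lemma η_A (x : M) (v : TangentSpace I x) : S.η x (S.A x v) = 0 := by
  have h := mvfderiv_inner_const S.g (S.smooth_ξ x) (S.smooth_ξ x) (c := 1)
    (Eventually.of_forall fun y => by rw [S.inner_ξ, S.η_ξ]) v
  rw [S.inner_ξ] at h
  change S.η x (leviCivita S.g S.ξ x v) = 0
  linarith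

variable {S}

/-- Since η = g(ξ, ·) and ∇ is metric and torsion free, dη(X,Y) = g(∇_X ξ, Y) - g(∇_Y ξ, X). -/
lemma IsAlmostKenmotsu.inner_A (hS : S.IsAlmostKenmotsu) (x : M) (v w : TangentSpace I x) :
    S.g.inner x (S.A x v) w = S.g.inner x v (S.A x w) := by
  obtain ⟨X, hX, rfl⟩ := exists_smooth_extension v
  obtain ⟨Y, hY, rfl⟩ := exists_smooth_extension w
  replace hX := hX.self_of_nhds
  replace hY := hY.self_of_nhds
  have h := hS.closed x X Y hX hY
  have hξ := (S.smooth_ξ x).mdifferentiableAt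
  have e : ∀ Z : Π x : M, TangentSpace I x, (fun y => S.η y (Z y)) = S.g.onFields S.ξ Z :=
    fun Z => funext fun y => (S.inner_ξ_left y _).symm
  rw [dOne, e, e, leviCivita_metric S.g hX.mdifferentiableAt hξ hY.mdifferentiableAt,
    leviCivita_metric S.g hY.mdifferentiableAt hξ hX.mdifferentiableAt,
    ← leviCivita_torsion S.g hX.mdifferentiableAt hY.mdifferentiableAt, map_sub,
    S.inner_ξ_left, S.inner_ξ_left] at h
  change S.g.inner x (leviCivita S.g S.ξ x (X x)) (Y x) = S.g.inner x (X x) (leviCivita S.g S.ξ x (Y x))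
  rw [S.g.symm x (X x)]
  linarith

lemma IsAlmostKenmotsu.A_ξ (hS : S.IsAlmostKenmotsu) (x : M) : S.A x (S.ξ x) = 0 := by
  apply eq_of_inner_eq S.g
  intro z
  rw [hS.inner_A, S.inner_ξ_left, S.η_A]
  simp

/-! ### Adapted orthonormal frames (e, φe, ξ) -/

variable (S)

/-- `e` is, near `x`, a smooth unit vector field in `ker η`. -/
def UnitHorizontalNear (e : Π x : M, TangentSpace I x) (x : M) : Prop :=
  ∀ᶠ y in 𝓝 x, SmoothFieldAt e y ∧ S.g.inner y (e y) (e y) = 1 ∧ S.η y (e y) = 0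

variable {S}

lemma UnitHorizontalNear.eventually {e : Π x : M, TangentSpace I x} {x : M}
    (he : S.UnitHorizontalNear e x) : ∀ᶠ y in 𝓝 x, S.UnitHorizontalNear e y :=
  eventually_eventually_nhds.2 he

lemma UnitHorizontalNear.phi {e : Π x : M, TangentSpace I x} {x : M}
    (he : S.UnitHorizontalNear e x) : S.UnitHorizontalNear (fun y => S.φ y (e y)) x := by
  filter_upwards [he] with y hy
  refine ⟨hy.1.apply_endo S.smooth_φ, ?_, S.η_φ y _⟩
  rw [S.compatible, hy.2.1, hy.2.2]
  simp

lemma UnitHorizontalNear.frame {e : Π x : M, TangentSpace I x} {x : M}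
    (he : S.UnitHorizontalNear e x) :
    IsOrthonormalFrameNear S.g ![e, fun y => S.φ y (e y), S.ξ] x where
  smooth := by
    filter_upwards [he] with y hy i
    fin_cases i
    · exact hy.1
    · exact hy.1.apply_endo S.smooth_φ
    · exact S.smooth_ξ y
  orthonormal := by
    filter_upwards [he, he.phi] with y hy hy'
    intro i j
    fin_cases i <;> fin_cases j <;>
      simp [hy.2.1, hy.2.2, hy'.2.1, S.inner_φ_self, S.inner_φ_left, S.inner_ξ, S.inner_ξ_left,
        S.η_φ, S.η_ξ, S.φ_ξ]

lemma UnitHorizontalNear.expand (h3 : Module.finrank ℝ E = 3) {e : Π x : M, TangentSpace I x} {x : M}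
    (he : S.UnitHorizontalNear e x) (v : TangentSpace I x) :
    v = S.g.inner x v (e x) • e x + S.g.inner x v (S.φ x (e x)) • S.φ x (e x) + S.η x v • S.ξ x := by
  have h := eq_sum_of_orthonormal S.g h3 he.frame.orthonormal.self_of_nhds v
  simpa [Fin.sum_univ_three, S.inner_ξ] using h

lemma UnitHorizontalNear.smoothFieldAt_A (h3 : Module.finrank ℝ E = 3)
    {e : Π x : M, TangentSpace I x} {x : M}
    (he : S.UnitHorizontalNear e x) {X : Π x : M, TangentSpace I x} (hX : SmoothFieldAt X x) :
    SmoothFieldAt (fun y => S.A y (X y)) x :=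
  he.frame.smoothFieldAt_leviCivita h3 hX (S.smooth_ξ x)

/-- Extend a vector that is not a multiple of ξ, project it to ker η, and normalise where the
projection stays nonzero. -/
lemma exists_unitHorizontalNear (h3 : Module.finrank ℝ E = 3) (S : AlmostContactMetric I M) (x : M) :
    ∃ e, S.UnitHorizontalNear e x := by
  have : FiniteDimensional ℝ (TangentSpace I x) := inferInstanceAs (FiniteDimensional ℝ E)
  have hd : Module.finrank ℝ (TangentSpace I x) = 3 := h3
  obtain ⟨v, hv⟩ : ∃ v : TangentSpace I x, v - S.η x v • S.ξ x ≠ 0 := by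
    by_contra! hcon
    have := finrank_le_one (R := ℝ) (S.ξ x) fun w => ⟨S.η x w, (sub_eq_zero.1 (hcon w)).symm⟩
    omega
  obtain ⟨X, hX, rfl⟩ := exists_smooth_extension v
  set W : Π x : M, TangentSpace I x := fun y => X y - S.η y (X y) • S.ξ y with hW
  have hWs : ∀ᶠ y in 𝓝 x, SmoothFieldAt W y := by
    filter_upwards [hX] with y hy
    exact hy.sub (SmoothFieldAt.smul (S.contMDiffAt_η hy) (S.smooth_ξ y))
  have hpos : ∀ᶠ y in 𝓝 x, 0 < S.g.inner y (W y) (W y) := by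
    have hc : ContinuousAt (S.g.onFields W W) x :=
      (contMDiffAt_metric S.g hWs.self_of_nhds hWs.self_of_nhds).continuousAt
    exact hc.eventually (lt_mem_nhds (S.g.pos x (W x) hv))
  refine ⟨fun y => (√(S.g.inner y (W y) (W y)))⁻¹ • W y, ?_⟩
  filter_upwards [hWs, hpos] with y h1 h2
  refine ⟨SmoothFieldAt.smul (contMDiffAt_inv_sqrt (contMDiffAt_metric S.g h1 h1) h2) h1,
    inner_normalize S.g h2, ?_⟩
  simp [hW, S.η_ξ]

end AlmostContactMetric
end AlmostKenmotsu

end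

/-! ### Trace and norm of ∇ξ on the canonical distribution -/

noncomputable section
open Filter Topology
namespace AlmostKenmotsu
variable {E : Type*} [NormedAddCommGroup E] [NormedSpace ℝ E]
  {H : Type*} [TopologicalSpace H] {I : ModelWithCorners ℝ E H}
  {M : Type*} [TopologicalSpace M] [ChartedSpace H M] [IsManifold I ∞ M]
  [FiniteDimensional ℝ E]

lemma mlieBracket_congr {X X' Y Y' : Π x : M, TangentSpace I x} {x : M}
    (hX : ∀ᶠ y in 𝓝 x, X y = X' y) (hY : ∀ᶠ y in 𝓝 x, Y y = Y' y) :
    VectorField.mlieBracket I X Y x = VectorField.mlieBracket I X' Y' x :=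
  EventuallyEq.mlieBracket_vectorField_eq hX hY

lemma mlieBracket_neg_right {X Y : Π x : M, TangentSpace I x} {x : M} (hY : MDiffAt (T% Y) x) :
    VectorField.mlieBracket I X (fun y => -Y y) x = -VectorField.mlieBracket I X Y x := by
  have h := VectorField.mlieBracket_const_smul_right (V := X) (c := (-1 : ℝ)) hY
  have e : (-1 : ℝ) • Y = fun y => -Y y := by funext y; simp
  rw [e] at h
  simpa using h

namespace AlmostContactMetric

variable {S : AlmostContactMetric I M} {e : Π x : M, TangentSpace I x} {x : M}

lemma UnitHorizontalNear.phi_phi (he : S.UnitHorizontalNear e x) :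
    ∀ᶠ y in 𝓝 x, S.φ y (S.φ y (e y)) = -e y := by
  filter_upwards [he] with y hy
  exact S.φ_φ hy.2.2

/-- `[X, ξ] = A X - ∇_ξ X`. -/
lemma mlieBracket_ξ (S : AlmostContactMetric I M) {X : Π x : M, TangentSpace I x} {x : M}
    (hX : SmoothFieldAt X x) :
    VectorField.mlieBracket I X S.ξ x = S.A x (X x) - leviCivita S.g X x (S.ξ x) :=
  (leviCivita_torsion S.g hX.mdifferentiableAt (S.smooth_ξ x).mdifferentiableAt).symm

/-- The divergence of `ξ` is `2`. -/
lemma UnitHorizontalNear.trace_A (he : S.UnitHorizontalNear e x) (hS : S.IsAlmostKenmotsu) :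
    S.g.inner x (S.A x (e x)) (e x) + S.g.inner x (S.A x (S.φ x (e x))) (S.φ x (e x)) = 2 := by
  have hx := he.self_of_nhds
  have hx' := he.phi.self_of_nhds
  have hd := hS.dΦ x S.ξ e (fun y => S.φ y (e y)) (S.smooth_ξ x) hx.1 hx'.1
  -- The frame components of Φ are constant, so only the bracket terms of dΦ(ξ, e, φe) survive; [e,
  -- φe] is paired with ξ, which Φ annihilates.
  have c1 : mvfderiv I (fun y => fundamentalForm S.g S.φ y (e y) (S.φ y (e y))) x = 0 := by
    refine (mvfderiv_congr (f' := fun _ => (-1 : ℝ)) ?_).trans (mvfderiv_const _)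
    filter_upwards [he.phi_phi, he] with y h1 h2
    rw [fundamentalForm, h1, map_neg, h2.2.1]
  have c2 : mvfderiv I (fun y => fundamentalForm S.g S.φ y (S.φ y (e y)) (S.ξ y)) x = 0 := by
    refine (mvfderiv_congr (f' := fun _ => (0 : ℝ)) ?_).trans (mvfderiv_const _)
    filter_upwards with y
    rw [fundamentalForm, S.φ_ξ, map_zero]
  have c3 : mvfderiv I (fun y => fundamentalForm S.g S.φ y (S.ξ y) (e y)) x = 0 := by
    refine (mvfderiv_congr (f' := fun _ => (0 : ℝ)) ?_).trans (mvfderiv_const _)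
    filter_upwards with y
    rw [fundamentalForm, S.inner_ξ_left, S.η_φ]
  have hpp := he.phi_phi.self_of_nhds
  have t1 := mvfderiv_inner_const S.g hx.1 hx.1 (he.mono fun y hy => hy.2.1) (S.ξ x)
  have t2 := mvfderiv_inner_const S.g hx'.1 hx'.1 (he.phi.mono fun y hy => hy.2.1) (S.ξ x)
  simp only [dTwo, wedgeOneTwo, c1, c2, c3] at hd
  rw [VectorField.mlieBracket_swap_apply (V := S.ξ) (W := e), S.mlieBracket_ξ hx.1,
    S.mlieBracket_ξ hx'.1] at hd
  simp [fundamentalForm, hpp, S.φ_ξ, S.η_ξ, hx.2.1, hx.2.2, S.η_φ, S.inner_ξ_left] at hd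
  linarith

/-- The endomorphism `h` is trace free. -/
lemma UnitHorizontalNear.trace_h (he : S.UnitHorizontalNear e x) :
    S.g.inner x (S.h e x) (e x) + S.g.inner x (S.h (fun y => S.φ y (e y)) x) (S.φ x (e x)) = 0 := by
  have hx := he.self_of_nhds
  have e1 : VectorField.mlieBracket I S.ξ (fun y => S.φ y (S.φ y (e y))) x
      = -VectorField.mlieBracket I S.ξ e x :=
    (mlieBracket_congr (Eventually.of_forall fun _ => rfl) he.phi_phi).trans
      (mlieBracket_neg_right hx.1.mdifferentiableAt)
  have hpp := he.phi_phi.self_of_nhds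
  simp only [h, e1]
  simp [S.inner_φ_left, hpp]
  ring

/-- The endomorphism `h'` is trace free. -/
lemma UnitHorizontalNear.trace_h' (he : S.UnitHorizontalNear e x) :
    S.g.inner x (S.h' e x) (e x) + S.g.inner x (S.h' (fun y => S.φ y (e y)) x) (S.φ x (e x)) = 0 := by
  have hx := he.self_of_nhds
  have hx' := he.phi.self_of_nhds
  have e1 : VectorField.mlieBracket I S.ξ (fun y => S.φ y (S.φ y (e y))) x
      = -VectorField.mlieBracket I S.ξ e x :=
    (mlieBracket_congr (Eventually.of_forall fun _ => rfl) he.phi_phi).trans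
      (mlieBracket_neg_right hx.1.mdifferentiableAt)
  have e2 : VectorField.mlieBracket I S.ξ (fun y => S.φ y (S.φ y (S.φ y (e y)))) x
      = -VectorField.mlieBracket I S.ξ (fun y => S.φ y (e y)) x :=
    (mlieBracket_congr (Eventually.of_forall fun _ => rfl) he.phi.phi_phi).trans
      (mlieBracket_neg_right hx'.1.mdifferentiableAt)
  have hpp := he.phi_phi.self_of_nhds
  simp only [h', h, e1, e2]
  simp [S.inner_φ_left, hpp]
  ring

/-- `g(R(X, ξ)ξ, X)` in terms of `A`. -/
lemma UnitHorizontalNear.inner_curvature_ξ (h3 : Module.finrank ℝ E = 3)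
    (he : S.UnitHorizontalNear e x) (hS : S.IsAlmostKenmotsu)
    {X : Π x : M, TangentSpace I x} (hX : SmoothFieldAt X x) :
    S.g.inner x (curvature S.g X S.ξ S.ξ x) (X x)
      = - mvfderiv I (fun y => S.g.inner y (S.A y (X y)) (X y)) x (S.ξ x)
        + 2 * S.g.inner x (S.A x (X x)) (leviCivita S.g X x (S.ξ x))
        - S.g.inner x (S.A x (X x)) (S.A x (X x)) := by
  have h0 : (fun y => leviCivita S.g S.ξ y (S.ξ y)) = 0 := funext fun y => hS.A_ξ y
  have hAX := he.smoothFieldAt_A h3 hX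
  have h1 := leviCivita_metric S.g (S.smooth_ξ x).mdifferentiableAt hAX.mdifferentiableAt
    hX.mdifferentiableAt
  have h2 := hS.inner_A x (VectorField.mlieBracket I X S.ξ x) (X x)
  rw [S.mlieBracket_ξ hX] at h2
  rw [curvature, h0, S.mlieBracket_ξ hX]
  change mvfderiv I (fun y => S.g.inner y (S.A y (X y)) (X y)) x (S.ξ x)
    = S.g.inner x (leviCivita S.g (fun y => S.A y (X y)) x (S.ξ x)) (X x) + _ at h1
  change S.g.inner x (leviCivita S.g 0 x (X x)
    - leviCivita S.g (fun y => S.A y (X y)) x (S.ξ x)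
    - S.A x (S.A x (X x) - leviCivita S.g X x (S.ξ x))) (X x) = _
  rw [CovariantDerivative.zero, h1, map_sub, map_sub, sub_apply, sub_apply, h2,
    map_sub, sub_apply, S.g.symm x (leviCivita S.g X x (S.ξ x))]
  simp
  ring

/-- The components of `A` in an adapted frame satisfy `α² + β² + 2 r² = -2k`. -/
lemma UnitHorizontalNear.sq_A (h3 : Module.finrank ℝ E = 3)
    (he : S.UnitHorizontalNear e x) (hS : S.IsAlmostKenmotsu) {k μ : M → ℝ}
    (hnull : S.IsGeneralizedKMu k μ ∨ S.IsGeneralizedKMu' k μ) :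
    S.g.inner x (S.A x (e x)) (e x) ^ 2
      + S.g.inner x (S.A x (S.φ x (e x))) (S.φ x (e x)) ^ 2
      + 2 * S.g.inner x (S.A x (e x)) (S.φ x (e x)) ^ 2 = -2 * k x := by
  have hx := he.self_of_nhds
  have hx' := he.phi.self_of_nhds
  have r1 := he.inner_curvature_ξ h3 hS hx.1
  have r2 := he.inner_curvature_ξ h3 hS hx'.1
  -- Under either nullity condition the μ-contribution is μ times a trace that vanishes.
  have hsum : S.g.inner x (curvature S.g e S.ξ S.ξ x) (e x)
      + S.g.inner x (curvature S.g (fun y => S.φ y (e y)) S.ξ S.ξ x) (S.φ x (e x)) = 2 * k x := by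
    have t := he.trace_h
    have t' := he.trace_h'
    rcases hnull with hn | hn
    · rw [hn.nullity x e S.ξ hx.1 (S.smooth_ξ x), hn.nullity x _ S.ξ hx'.1 (S.smooth_ξ x)]
      simp [S.η_ξ, hx.2.1, hx.2.2, S.η_φ, S.compatible]
      linear_combination (μ x) * t
    · rw [hn.nullity x e S.ξ hx.1 (S.smooth_ξ x), hn.nullity x _ S.ξ hx'.1 (S.smooth_ξ x)]
      simp [S.η_ξ, hx.2.1, hx.2.2, S.η_φ, S.compatible]
      linear_combination (μ x) * t'
  -- The trace of A is constantly 2, so the derivative terms along ξ cancel.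
  have hder : mvfderiv I (fun y => S.g.inner y (S.A y (e y)) (e y)) x (S.ξ x)
      + mvfderiv I (fun y => S.g.inner y (S.A y (S.φ y (e y))) (S.φ y (e y))) x (S.ξ x) = 0 := by
    have d1 : MDiffAt (fun y => S.g.inner y (S.A y (e y)) (e y)) x :=
      (contMDiffAt_metric S.g (he.smoothFieldAt_A h3 hx.1) hx.1).mdifferentiableAt (by simp)
    have d2 : MDiffAt (fun y => S.g.inner y (S.A y (S.φ y (e y))) (S.φ y (e y))) x :=
      (contMDiffAt_metric S.g (he.smoothFieldAt_A h3 hx'.1) hx'.1).mdifferentiableAt (by simp)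
    have := mvfderiv_fun_add d1 d2
    rw [← add_apply, ← this, mvfderiv_congr (f' := fun _ => (2 : ℝ))
      (he.eventually.mono fun y hy => hy.trace_A hS), mvfderiv_const]
    rfl
  have t1 := mvfderiv_inner_const S.g hx.1 hx.1 (he.mono fun y hy => hy.2.1) (S.ξ x)
  have t2 := mvfderiv_inner_const S.g hx'.1 hx'.1 (he.phi.mono fun y hy => hy.2.1) (S.ξ x)
  have t3 := mvfderiv_inner_const S.g hx.1 hx'.1
    (Eventually.of_forall fun y => S.inner_φ_self y (e y)) (S.ξ x)
  have s1 := he.expand h3 (S.A x (e x))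
  have s2 := he.expand h3 (S.A x (S.φ x (e x)))
  rw [S.η_A, zero_smul, add_zero] at s1 s2
  have sy : S.g.inner x (S.A x (S.φ x (e x))) (e x) = S.g.inner x (S.A x (e x)) (S.φ x (e x)) := by
    rw [hS.inner_A, S.g.symm]
  rw [sy] at s2
  have u : ∀ v, S.g.inner x (S.A x (e x)) v
      = S.g.inner x (S.A x (e x)) (e x) * S.g.inner x v (e x)
        + S.g.inner x (S.A x (e x)) (S.φ x (e x)) * S.g.inner x v (S.φ x (e x)) := by
    intro v
    conv_lhs => rw [s1]
    simp [S.g.symm x v]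
  have u' : ∀ v, S.g.inner x (S.A x (S.φ x (e x))) v
      = S.g.inner x (S.A x (e x)) (S.φ x (e x)) * S.g.inner x v (e x)
        + S.g.inner x (S.A x (S.φ x (e x))) (S.φ x (e x)) * S.g.inner x v (S.φ x (e x)) := by
    intro v
    conv_lhs => rw [s2]
    simp [S.g.symm x v]
  rw [u (leviCivita S.g e x (S.ξ x)), u (S.A x (e x))] at r1
  rw [u' (leviCivita S.g _ x (S.ξ x)), u' (S.A x (S.φ x (e x))), sy] at r2
  -- `t1`, `t2`, `t3` say that ∇_ξ acts on (e, φe) by a skew matrix; its trace product with the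
  -- symmetric matrix of A is zero.
  linear_combination r1 + r2 - hsum - hder + S.g.inner x (S.A x (e x)) (e x) * t1
    + S.g.inner x (S.A x (S.φ x (e x))) (S.φ x (e x)) * t2
    + 2 * S.g.inner x (S.A x (e x)) (S.φ x (e x)) * t3

/-- The matrix of `A` on `ker η` in the frame `(e, φ e)`. -/
lemma UnitHorizontalNear.A_apply (h3 : Module.finrank ℝ E = 3)
    (he : S.UnitHorizontalNear e x) (hS : S.IsAlmostKenmotsu) :
    S.A x (e x) = S.g.inner x (S.A x (e x)) (e x) • e x
        + S.g.inner x (S.A x (e x)) (S.φ x (e x)) • S.φ x (e x) ∧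
    S.A x (S.φ x (e x)) = S.g.inner x (S.A x (e x)) (S.φ x (e x)) • e x
        + (2 - S.g.inner x (S.A x (e x)) (e x)) • S.φ x (e x) := by
  have s1 := he.expand h3 (S.A x (e x))
  have s2 := he.expand h3 (S.A x (S.φ x (e x)))
  rw [S.η_A, zero_smul, add_zero] at s1 s2
  refine ⟨s1, ?_⟩
  have sy : S.g.inner x (S.A x (S.φ x (e x))) (e x) = S.g.inner x (S.A x (e x)) (S.φ x (e x)) := by
    rw [hS.inner_A, S.g.symm]
  rw [sy] at s2
  rw [← he.trace_A hS, add_sub_cancel_left]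
  exact s2

/-! ### Eigenframes of ∇ξ and the vanishing of their bracket -/

variable (S) in
/-- `V` is, near `x`, a smooth unit section of `ker η` with `∇_V ξ = (1 + l) V` and
`∇_{φV} ξ = (1 - l) φV`. -/
structure EigenframeNear (l : M → ℝ) (V : Π x : M, TangentSpace I x) (x : M) : Prop where
  unit : S.UnitHorizontalNear V x
  eigen : ∀ᶠ y in 𝓝 x, S.A y (V y) = (1 + l y) • V y ∧
    S.A y (S.φ y (V y)) = (1 - l y) • S.φ y (V y)

lemma EigenframeNear.eventually {l : M → ℝ} {V : Π x : M, TangentSpace I x} {x : M}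
    (hV : S.EigenframeNear l V x) : ∀ᶠ y in 𝓝 x, S.EigenframeNear l V y := by
  filter_upwards [hV.unit.eventually, hV.eigen.eventually_nhds] with y h1 h2 using ⟨h1, h2⟩

/-- The diagonal entries of A for e and φe sum to 2, so one is at least 1. This keeps the first
coefficient l + α - 1 of the eigenvector below away from zero. -/
lemma exists_unitHorizontalNear_one_le (h3 : Module.finrank ℝ E = 3) (hS : S.IsAlmostKenmotsu)
    (x : M) : ∃ e, S.UnitHorizontalNear e x ∧ 1 ≤ S.g.inner x (S.A x (e x)) (e x) := by
  obtain ⟨e, he⟩ := exists_unitHorizontalNear h3 S x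
  by_cases h : 1 ≤ S.g.inner x (S.A x (e x)) (e x)
  · exact ⟨e, he, h⟩
  · refine ⟨_, he.phi, ?_⟩
    have := he.trace_A hS
    push Not at h
    linarith

/-- In the basis (e, Pe), T - 1 is the trace-free symmetric matrix with rows (α-1, r) and (r, 1-α).
Its square is l² by `h`, so (l + α - 1, r) has eigenvalue l, and its rotation by P has eigenvalue
-l. -/
lemma eigenvectors_of_sq_eq {V : Type*} [AddCommGroup V] [Module ℝ V] {T P : V →ₗ[ℝ] V} {e : V}
    {α r l : ℝ} (h1 : T e = α • e + r • P e) (h2 : T (P e) = r • e + (2 - α) • P e)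
    (h3 : P (P e) = -e) (h : (α - 1) ^ 2 + r ^ 2 - l ^ 2 = 0) :
    T ((l + α - 1) • e + r • P e) = (1 + l) • ((l + α - 1) • e + r • P e) ∧
    T (P ((l + α - 1) • e + r • P e)) = (1 - l) • P ((l + α - 1) • e + r • P e) := by
  simp only [map_add, map_smul, h3, smul_neg, map_neg, h1, h2]
  constructor
  · match_scalars
    · linear_combination h
    · ring
  · match_scalars
    · ring
    · linear_combination -h

/-- The polynomial formula for the eigenvector is smooth in the entries of A and in l, and l is
smooth because -1-k stays positive; it remains to normalise. -/
lemma exists_eigenframeNear (h3 : Module.finrank ℝ E = 3) (hS : S.IsAlmostKenmotsu) {k μ : M → ℝ}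
    (hnull : S.IsGeneralizedKMu k μ ∨ S.IsGeneralizedKMu' k μ) (hk : ∀ x, k x < -1) (x : M) :
    ∃ V, S.EigenframeNear (fun y => √(-1 - k y)) V x := by
  obtain ⟨e, he, hpos⟩ := exists_unitHorizontalNear_one_le h3 hS x
  have hks : ContMDiff I 𝓘(ℝ, ℝ) ∞ k := hnull.elim (fun h => h.smooth_k) fun h => h.smooth_k
  have hl0 : ∀ y, 0 < -1 - k y := fun y => by linarith [hk y]
  set l : M → ℝ := fun y => √(-1 - k y) with hl
  have hls : ∀ y, ContMDiffAt I 𝓘(ℝ, ℝ) ∞ l y := fun y =>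
    contMDiffAt_sqrt (contMDiffAt_const.sub (hks y)) (hl0 y)
  set c : M → ℝ := fun y => l y + S.g.inner y (S.A y (e y)) (e y) - 1 with hc
  set r : M → ℝ := fun y => S.g.inner y (S.A y (e y)) (S.φ y (e y)) with hr
  have hrs : ∀ᶠ y in 𝓝 x, ContMDiffAt I 𝓘(ℝ, ℝ) ∞ r y := by
    filter_upwards [he, he.phi] with y hy hy'
    exact contMDiffAt_inner_leviCivita S.g hy.1 (S.smooth_ξ y) hy'.1
  have hcs : ∀ᶠ y in 𝓝 x, ContMDiffAt I 𝓘(ℝ, ℝ) ∞ c y := by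
    filter_upwards [he] with y hy
    exact ((hls y).add (contMDiffAt_inner_leviCivita S.g hy.1 (S.smooth_ξ y) hy.1)).sub
      contMDiffAt_const
  have hcpos : ∀ᶠ y in 𝓝 x, 0 < c y := by
    refine hcs.self_of_nhds.continuousAt.eventually (lt_mem_nhds ?_)
    have := Real.sqrt_pos.2 (hl0 x)
    simp only [hc, hl]
    linarith
  set W : Π x : M, TangentSpace I x := fun y => c y • e y + r y • S.φ y (e y) with hW
  have hWs : ∀ᶠ y in 𝓝 x, SmoothFieldAt W y := by
    filter_upwards [he, he.phi, hcs, hrs] with y hy hy' h1 h2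
    exact (SmoothFieldAt.smul h1 hy.1).add (SmoothFieldAt.smul h2 hy'.1)
  have hWpos : ∀ᶠ y in 𝓝 x, 0 < S.g.inner y (W y) (W y) := by
    filter_upwards [he, he.phi, hcpos] with y hy hy' h1
    have : S.g.inner y (W y) (W y) = c y ^ 2 + r y ^ 2 := by
      simp [hW, hy.2.1, hy'.2.1, S.inner_φ_self, S.g.symm y (S.φ y (e y)) (e y)]
      ring
    rw [this]
    positivity
  have hWe : ∀ᶠ y in 𝓝 x, S.A y (W y) = (1 + l y) • W y ∧
      S.A y (S.φ y (W y)) = (1 - l y) • S.φ y (W y) := by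
    filter_upwards [he.eventually] with y hy
    obtain ⟨a1, a2⟩ := hy.A_apply h3 hS
    have hq := hy.sq_A h3 hS hnull
    have ht := hy.trace_A hS
    have hl2 : l y ^ 2 = -1 - k y := Real.sq_sqrt (hl0 y).le
    have hpp := hy.phi_phi.self_of_nhds
    have hβ : S.g.inner y (S.A y (S.φ y (e y))) (S.φ y (e y))
        = 2 - S.g.inner y (S.A y (e y)) (e y) := by linarith
    rw [hβ] at hq
    -- With β = 2 - α, the identity α² + β² + 2r² = -2k becomes (α-1)² + r² = -1-k = l².
    have hsc : (S.g.inner y (S.A y (e y)) (e y) - 1) ^ 2 + r y ^ 2 - l y ^ 2 = 0 := by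
      simp only [hr]
      linear_combination (1 / 2) * hq - hl2
    exact eigenvectors_of_sq_eq (T := (S.A y).toLinearMap) (P := (S.φ y).toLinearMap) a1 a2 hpp hsc
  refine ⟨fun y => (√(S.g.inner y (W y) (W y)))⁻¹ • W y, ?_, ?_⟩
  · filter_upwards [hWs, hWpos, he] with y h1 h2 h3
    refine ⟨SmoothFieldAt.smul (contMDiffAt_inv_sqrt (contMDiffAt_metric S.g h1 h1) h2) h1,
      inner_normalize S.g h2, ?_⟩
    simp [hW, h3.2.2, S.η_φ]
  · filter_upwards [hWe] with y hy
    simp only [map_smul]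
    rw [hy.1, hy.2]
    exact ⟨smul_comm _ _ _, smul_comm _ _ _⟩

/-- Codazzi reads (1-l)∇_V φV - (1+l)∇_{φV} V = A[V, φV]. Comparing components with ∇_V φV - ∇_{φV}
V = [V, φV] shows that l annihilates both horizontal components. -/
lemma EigenframeNear.mlieBracket_eq_zero (h3 : Module.finrank ℝ E = 3) (hS : S.IsAlmostKenmotsu)
    {k μ : M → ℝ} (hnull : S.IsGeneralizedKMu k μ ∨ S.IsGeneralizedKMu' k μ)
    {l : M → ℝ} {V : Π x : M, TangentSpace I x} {x : M}
    (hl : MDiffAt l x) (hl0 : l x ≠ 0) (hdl : ∀ v, S.η x v = 0 → mvfderiv I l x v = 0)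
    (hV : S.EigenframeNear l V x) :
    VectorField.mlieBracket I V (fun y => S.φ y (V y)) x = 0 := by
  have hx := hV.unit.self_of_nhds
  have hx' := hV.unit.phi.self_of_nhds
  obtain ⟨a1, a2⟩ := hV.eigen.self_of_nhds
  have hd := hx.1.mdifferentiableAt
  have hd' := hx'.1.mdifferentiableAt
  have hR : curvature S.g V (fun y => S.φ y (V y)) S.ξ x = 0 := by
    rcases hnull with hn | hn <;> rw [hn.nullity x _ _ hx.1 hx'.1] <;> simp [hx.2.2, S.η_φ]
  -- `hdl` removes the derivative of the eigenvalue in horizontal directions.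
  have c1 : ∀ v, S.η x v = 0 → leviCivita S.g (fun y => S.A y (S.φ y (V y))) x v
      = (1 - l x) • leviCivita S.g (fun y => S.φ y (V y)) x v := by
    intro v hv
    have hf : MDiffAt (fun y => 1 - l y) x := mdifferentiableAt_const.sub hl
    rw [leviCivita_congr S.g (Y := fun y => (1 - l y) • S.φ y (V y)) (hf.smul_section hd')
      (hV.eigen.mono fun y hy => hy.2), leviCivita_smul S.g hf hd',
      mvfderiv_fun_sub mdifferentiableAt_const hl, mvfderiv_const]
    simp [hdl v hv]
  have c2 : ∀ v, S.η x v = 0 → leviCivita S.g (fun y => S.A y (V y)) x v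
      = (1 + l x) • leviCivita S.g V x v := by
    intro v hv
    have hf : MDiffAt (fun y => 1 + l y) x := mdifferentiableAt_const.add hl
    rw [leviCivita_congr S.g (Y := fun y => (1 + l y) • V y) (hf.smul_section hd)
      (hV.eigen.mono fun y hy => hy.1), leviCivita_smul S.g hf hd,
      mvfderiv_fun_add mdifferentiableAt_const hl, mvfderiv_const]
    simp [hdl v hv]
  have hB := leviCivita_torsion S.g hd hd'
  have hAB : ∀ w, S.g.inner x (S.A x (VectorField.mlieBracket I V (fun y => S.φ y (V y)) x)) w
    = S.g.inner x (VectorField.mlieBracket I V (fun y => S.φ y (V y)) x) (S.A x w) :=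
    fun w => hS.inner_A x _ w
  change leviCivita S.g (fun y => S.A y (S.φ y (V y))) x (V x)
    - leviCivita S.g (fun y => S.A y (V y)) x (S.φ x (V x))
    - S.A x (VectorField.mlieBracket I V (fun y => S.φ y (V y)) x) = 0 at hR
  rw [c1 _ hx.2.2, c2 _ (S.η_φ x _)] at hR
  have r1 := congrArg (fun w => S.g.inner x w (V x)) hR
  have r2 := congrArg (fun w => S.g.inner x w (S.φ x (V x))) hR
  have b1 := congrArg (fun w => S.g.inner x w (V x)) hB
  have b2 := congrArg (fun w => S.g.inner x w (S.φ x (V x))) hB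
  have b3 := congrArg (fun w => S.η x w) hB
  have t1 := mvfderiv_inner_const S.g hx.1 hx.1 (hV.unit.mono fun y hy => hy.2.1) (S.φ x (V x))
  have t2 := mvfderiv_inner_const S.g hx'.1 hx'.1 (hV.unit.phi.mono fun y hy => hy.2.1) (V x)
  have t3 := mvfderiv_inner_const S.g hx.1 (S.smooth_ξ x)
    (hV.unit.mono fun y hy => (S.inner_ξ y _).trans hy.2.2) (S.φ x (V x))
  have t4 := mvfderiv_inner_const S.g hx'.1 (S.smooth_ξ x)
    (Eventually.of_forall fun y => (S.inner_ξ y _).trans (S.η_φ y _)) (V x)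
  change _ + S.g.inner x (S.A x (S.φ x (V x))) (V x) = 0 at t3
  change _ + S.g.inner x (S.A x (V x)) (S.φ x (V x)) = 0 at t4
  rw [a2, S.inner_ξ] at t3
  rw [a1, S.inner_ξ] at t4
  have hg : S.g.inner x (S.φ x (V x)) (V x) = 0 := by rw [S.g.symm, S.inner_φ_self]
  simp only [map_sub, sub_apply, map_smul, smul_apply, map_zero, zero_apply, hAB, a1, a2,
    smul_eq_mul, hg, S.inner_φ_self, mul_zero, add_zero] at r1 r2 b1 b2 b3 t3 t4
  have ex := hV.unit.expand h3 (VectorField.mlieBracket I V (fun y => S.φ y (V y)) x)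
  have g1 : S.g.inner x (VectorField.mlieBracket I V (fun y => S.φ y (V y)) x) (V x) = 0 := by
    exact (mul_eq_zero.1 (by
      linear_combination (-1 / 2) * r1 + (1 - l x) / 2 * b1 - l x / 2 * t1 : l x * _ = 0)).resolve_left hl0
  have g2 : S.g.inner x (VectorField.mlieBracket I V (fun y => S.φ y (V y)) x) (S.φ x (V x)) = 0 := by
    exact (mul_eq_zero.1 (by
      linear_combination (1 / 2) * r2 - (1 + l x) / 2 * b2 + l x / 2 * t2 : l x * _ = 0)).resolve_left hl0
  -- Both η(∇_V φV) and η(∇_{φV} V) are off-diagonal entries of A up to sign, and V, φV are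
  -- eigenvectors.
  have g3 : S.η x (VectorField.mlieBracket I V (fun y => S.φ y (V y)) x) = 0 := by
    rw [← b3, t3, t4, sub_zero]
  rw [ex, g1, g2, g3]
  simp

lemma exists_commuting_unitHorizontalNear (h3 : Module.finrank ℝ E = 3) (hS : S.IsAlmostKenmotsu)
    {k μ : M → ℝ} (hnull : S.IsGeneralizedKMu k μ ∨ S.IsGeneralizedKMu' k μ)
    (hdk : ∀ (x : M) (v w : TangentSpace I x),
      wedgeOneOne (mvfderiv I k x) (S.η x) v w = 0)
    (hk : ∀ x, k x < -1) (x : M) :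
    ∃ V, S.UnitHorizontalNear V x ∧
      ∀ᶠ y in 𝓝 x, VectorField.mlieBracket I V (fun y => S.φ y (V y)) y = 0 := by
  obtain ⟨V, hV⟩ := exists_eigenframeNear h3 hS hnull hk x
  refine ⟨V, hV.unit, ?_⟩
  filter_upwards [hV.eventually] with y hy
  have hks : ContMDiff I 𝓘(ℝ, ℝ) ∞ k := hnull.elim (fun h => h.smooth_k) fun h => h.smooth_k
  have hl0 : 0 < -1 - k y := by linarith [hk y]
  have hsq := Real.sqrt_pos.2 hl0
  have hl : MDiffAt (fun y => √(-1 - k y)) y :=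
    (contMDiffAt_sqrt (contMDiffAt_const.sub (hks y)) hl0).mdifferentiableAt (by simp)
  refine hy.mlieBracket_eq_zero h3 hS hnull hl hsq.ne' fun v hv => ?_
  -- Evaluate dk∧η on (v, ξ). Differentiating l² = -1-k then gives 2l dl(v) = 0 with l positive.
  have h1 : mvfderiv I k y v = 0 := by simpa [wedgeOneOne, hv, S.η_ξ] using hdk y v (S.ξ y)
  have h2 : mvfderiv I (fun y => √(-1 - k y) * √(-1 - k y)) y v = mvfderiv I (fun y => -1 - k y) y v := by
    rw [mvfderiv_congr (Eventually.of_forall fun z => Real.mul_self_sqrt (by linarith [hk z]))]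
  rw [mvfderiv_fun_mul hl hl, mvfderiv_fun_sub mdifferentiableAt_const
    ((hks y).mdifferentiableAt (by simp)), mvfderiv_const] at h2
  simp [h1] at h2
  rcases h2 with h2 | h2
  · exact absurd h2 hsq.ne'
  · exact h2

end AlmostContactMetric
end AlmostKenmotsu

end

noncomputable section
open Filter Topology
namespace AlmostKenmotsu
variable {E : Type*} [NormedAddCommGroup E] [NormedSpace ℝ E]
  {H : Type*} [TopologicalSpace H] {I : ModelWithCorners ℝ E H}
  {M : Type*} [TopologicalSpace M] [ChartedSpace H M] [IsManifold I ∞ M] [FiniteDimensional ℝ E]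

/-! ### Smoothness of sections of homomorphism bundles -/

lemma contMDiffAt_clm_of_apply {F : Type*} [NormedAddCommGroup F] [NormedSpace ℝ F]
    {T : M → E →L[ℝ] F} {x : M} (h : ∀ v, ContMDiffAt I 𝓘(ℝ, F) ∞ (fun y => T y v) x) :
    ContMDiffAt I 𝓘(ℝ, E →L[ℝ] F) ∞ T x := by
  let d := Module.finrank ℝ E
  have hd : d = Module.finrank ℝ (Fin d → ℝ) := (Module.finrank_fin_fun ℝ).symm
  let e₁ := ContinuousLinearEquiv.ofFinrankEq hd
  let e₂ := (e₁.arrowCongr (1 : F ≃L[ℝ] F)).trans (ContinuousLinearEquiv.piRing (Fin d))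
  have h1 : ContMDiffAt I 𝓘(ℝ, Fin d → F) ∞ (fun y => e₂ (T y)) x :=
    contMDiffAt_pi_space.2 fun i => h _
  have h2 := (e₂.symm.contDiff (n := ∞)).contMDiff.contMDiffAt.comp x h1
  exact h2.congr_of_eventuallyEq (Eventually.of_forall fun y => (e₂.symm_apply_apply _).symm)

/-- In trivialisations it is enough to test on fixed model vectors, and the local extension of a
tangent vector has constant coordinates near the point. -/
lemma contMDiffAt_hom_of_apply {F : Type*} [NormedAddCommGroup F] [NormedSpace ℝ F]
    {V : M → Type*} [∀ x, AddCommGroup (V x)] [∀ x, Module ℝ (V x)] [∀ x, TopologicalSpace (V x)]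
    [TopologicalSpace (TotalSpace F V)]
    [FiberBundle F V] [VectorBundle ℝ F V] [∀ x, IsTopologicalAddGroup (V x)]
    [∀ x, ContinuousSMul ℝ (V x)] [ContMDiffVectorBundle ∞ F V I]
    {T : Π x : M, TangentSpace I x →L[ℝ] V x} {x : M}
    (h : ∀ X : Π x : M, TangentSpace I x, SmoothFieldAt X x →
      ContMDiffAt I (I.prod 𝓘(ℝ, F)) ∞ (fun y => TotalSpace.mk' F y (T y (X y))) x) :
    ContMDiffAt I (I.prod 𝓘(ℝ, E →L[ℝ] F)) ∞
      (fun y => TotalSpace.mk' (E →L[ℝ] F) (E := fun x : M => TangentSpace I x →L[ℝ] V x) y (T y))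
      x := by
  rw [contMDiffAt_hom_bundle]
  refine ⟨contMDiffAt_id, contMDiffAt_clm_of_apply fun v => ?_⟩
  have hX := FiberBundle.contMDiffAt_extend (k := ∞) I E (V := (TangentSpace I : M → Type _))
    ((trivializationAt E (TangentSpace I) x).symm x v)
  have h1 := h _ hX
  rw [contMDiffAt_section] at h1
  refine h1.congr_of_eventuallyEq ?_
  filter_upwards [(trivializationAt E (TangentSpace I) x).open_baseSet.mem_nhds
      (FiberBundle.mem_baseSet_trivializationAt' x),
    (trivializationAt F V x).open_baseSet.mem_nhds
      (FiberBundle.mem_baseSet_trivializationAt' x)] with y h1 h2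
  rw [ContinuousLinearMap.inCoordinates_eq h1 h2]
  have h3 := FiberBundle.mem_baseSet_trivializationAt' (F := E) (E := (TangentSpace I : M → Type _)) x
  simp [FiberBundle.extend, Trivialization.apply_mk_symm _ h3]

/-! ### Parallel frames on surfaces -/

/-- Near `x`, `(e, J e)` is a smooth orthonormal frame of commuting vector fields. -/
structure IsCommutingFrameNear (g : RiemannianMetric I M)
    (J : Π x : M, TangentSpace I x →L[ℝ] TangentSpace I x) (e : Π x : M, TangentSpace I x) (x : M) :
    Prop where
  smooth : ∀ᶠ y in 𝓝 x, SmoothFieldAt e y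
  smooth_J : ∀ᶠ y in 𝓝 x, SmoothFieldAt (fun y => J y (e y)) y
  unit : ∀ᶠ y in 𝓝 x, g.inner y (e y) (e y) = 1
  comm : ∀ᶠ y in 𝓝 x, VectorField.mlieBracket I e (fun y => J y (e y)) y = 0

variable {g : RiemannianMetric I M} {J : Π x : M, TangentSpace I x →L[ℝ] TangentSpace I x}
  {e : Π x : M, TangentSpace I x} {x : M}

lemma IsCommutingFrameNear.eventually (he : IsCommutingFrameNear g J e x) :
    ∀ᶠ y in 𝓝 x, IsCommutingFrameNear g J e y := by
  filter_upwards [he.smooth.eventually_nhds, he.smooth_J.eventually_nhds, he.unit.eventually_nhds,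
    he.comm.eventually_nhds] with y h1 h2 h3 h4 using ⟨h1, h2, h3, h4⟩

lemma inner_self_J (hsq : ∀ (x : M) (v : TangentSpace I x), J x (J x v) = -v)
    (hJ : ∀ (x : M) (v w : TangentSpace I x), g.inner x (J x v) (J x w) = g.inner x v w)
    (x : M) (v : TangentSpace I x) : g.inner x v (J x v) = 0 := by
  have h := hJ x v (J x v)
  rw [hsq, map_neg, g.symm] at h
  linarith

lemma inner_J (hsq : ∀ (x : M) (v : TangentSpace I x), J x (J x v) = -v)
    (hJ : ∀ (x : M) (v w : TangentSpace I x), g.inner x (J x v) (J x w) = g.inner x v w)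
    (x : M) (v w : TangentSpace I x) : g.inner x v (J x w) = -g.inner x w (J x v) := by
  have h := hJ x v (J x w)
  rw [hsq, map_neg, g.symm] at h
  linarith

lemma IsCommutingFrameNear.expand (h2 : Module.finrank ℝ E = 2)
    (hsq : ∀ (x : M) (v : TangentSpace I x), J x (J x v) = -v)
    (hJ : ∀ (x : M) (v w : TangentSpace I x), g.inner x (J x v) (J x w) = g.inner x v w)
    (he : IsCommutingFrameNear g J e x) (v : TangentSpace I x) :
    v = g.inner x v (e x) • e x + g.inner x v (J x (e x)) • J x (e x) := by
  have hu : ∀ i j, g.inner x (![e x, J x (e x)] i) (![e x, J x (e x)] j) = if i = j then 1 else 0 := by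
    have h1 := he.unit.self_of_nhds
    have h2 := inner_self_J hsq hJ x (e x)
    intro i j
    fin_cases i <;> fin_cases j <;> simp [h1, h2, hJ, g.symm x (J x (e x)) (e x)]
  simpa using eq_sum_of_orthonormal g h2 hu v

/-- On a surface only g(∇e, Je) can be nonzero. Commuting means ∇_e Je = ∇_{Je} e, so g(∇_e e, Je) =
-g(∇_{Je} e, e) = 0 and g(∇_{Je} e, Je) = g(∇_e Je, Je) = 0. -/
lemma IsCommutingFrameNear.parallel (h2 : Module.finrank ℝ E = 2)
    (hsq : ∀ (x : M) (v : TangentSpace I x), J x (J x v) = -v)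
    (hJ : ∀ (x : M) (v w : TangentSpace I x), g.inner x (J x v) (J x w) = g.inner x v w)
    (he : IsCommutingFrameNear g J e x) (v : TangentSpace I x) :
    leviCivita g e x v = 0 ∧ leviCivita g (fun y => J y (e y)) x v = 0 := by
  have s1 := he.smooth.self_of_nhds
  have s2 := he.smooth_J.self_of_nhds
  have t1 := mvfderiv_inner_const g s1 s1 he.unit
  have t2 := mvfderiv_inner_const g s2 s2 (he.unit.mono fun y hy => (hJ y _ _).trans hy)
  have t3 := mvfderiv_inner_const g s1 s2 (Eventually.of_forall fun y => inner_self_J hsq hJ y (e y))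
  have hB := leviCivita_torsion g s1.mdifferentiableAt s2.mdifferentiableAt
  rw [he.comm.self_of_nhds, sub_eq_zero] at hB
  have p1 : ∀ v, g.inner x (leviCivita g e x v) (J x (e x)) = 0 := by
    intro v
    have a1 := t3 (e x)
    rw [hB] at a1
    have a2 := t1 (J x (e x))
    have a3 := t2 (e x)
    rw [hB] at a3
    rw [he.expand h2 hsq hJ v]
    simp only [map_add, map_smul, add_apply, smul_apply, smul_eq_mul]
    linear_combination g.inner x v (e x) * (a1 - (1 / 2) * a2)
      + g.inner x v (J x (e x)) * ((1 / 2) * a3)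
  constructor
  · rw [he.expand h2 hsq hJ (leviCivita g e x v), p1]
    have := t1 v
    rw [show g.inner x (leviCivita g e x v) (e x) = 0 by linarith]
    simp
  · rw [he.expand h2 hsq hJ (leviCivita g (fun y => J y (e y)) x v)]
    have := t2 v
    have a := t3 v
    rw [p1, zero_add] at a
    rw [a, show g.inner x (leviCivita g (fun y => J y (e y)) x v) (J x (e x)) = 0 by linarith]
    simp

lemma IsCommutingFrameNear.leviCivita_eq (h2 : Module.finrank ℝ E = 2)
    (hsq : ∀ (x : M) (v : TangentSpace I x), J x (J x v) = -v)
    (hJ : ∀ (x : M) (v w : TangentSpace I x), g.inner x (J x v) (J x w) = g.inner x v w)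
    (he : IsCommutingFrameNear g J e x) {a b : M → ℝ} (ha : MDiffAt a x) (hb : MDiffAt b x)
    {Z : Π x : M, TangentSpace I x}
    (hZ : ∀ᶠ y in 𝓝 x, Z y = a y • e y + b y • J y (e y)) (v : TangentSpace I x) :
    leviCivita g Z x v = mvfderiv I a x v • e x + mvfderiv I b x v • J x (e x) := by
  have s1 := he.smooth.self_of_nhds.mdifferentiableAt
  have s2 := he.smooth_J.self_of_nhds.mdifferentiableAt
  have p := he.parallel h2 hsq hJ v
  have d1 := ha.smul_section s1
  have d2 := hb.smul_section s2
  rw [leviCivita_congr g (mdifferentiableAt_add_section d1 d2) hZ]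
  refine (leviCivita_add g d1 d2 v).trans ?_
  refine (congrArg₂ (· + ·) (leviCivita_smul g ha s1 v) (leviCivita_smul g hb s2 v)).trans ?_
  rw [p.1, p.2]
  simp

/-- In a parallel frame ∇ differentiates components as functions, so each component of the curvature
is XYa - YXa - [X,Y]a = 0. -/
lemma IsCommutingFrameNear.curvature_eq_zero [I.Boundaryless] (h2 : Module.finrank ℝ E = 2)
    (hsq : ∀ (x : M) (v : TangentSpace I x), J x (J x v) = -v)
    (hJ : ∀ (x : M) (v w : TangentSpace I x), g.inner x (J x v) (J x w) = g.inner x v w)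
    (he : IsCommutingFrameNear g J e x) {X Y Z : Π x : M, TangentSpace I x}
    (hX : SmoothFieldAt X x) (hY : SmoothFieldAt Y x) (hZ : SmoothFieldAt Z x) :
    curvature g X Y Z x = 0 := by
  have : CompleteSpace E := FiniteDimensional.complete ℝ E
  have ha := contMDiffAt_metric g hZ he.smooth.self_of_nhds
  have hb := contMDiffAt_metric g hZ he.smooth_J.self_of_nhds
  have hex : ∀ᶠ y in 𝓝 x, Z y = g.onFields Z e y • e y
      + g.onFields Z (fun y => J y (e y)) y • J y (e y) :=
    he.eventually.mono fun y hy => hy.expand h2 hsq hJ (Z y)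
  have hmd : ∀ {f : M → ℝ}, ContMDiffAt I 𝓘(ℝ, ℝ) ∞ f x → ∀ᶠ y in 𝓝 x, MDiffAt f y := by
    intro f hf
    have h1 : ContMDiffAt I 𝓘(ℝ, ℝ) 1 f x := hf.of_le (by simp)
    filter_upwards [(contMDiffAt_iff_contMDiffAt_nhds (by simp)).1 h1] with y hy
    exact hy.mdifferentiableAt (by simp)
  have key : ∀ {W : Π x : M, TangentSpace I x}, SmoothFieldAt W x → ∀ v,
      leviCivita g (fun y => leviCivita g Z y (W y)) x v
      = mvfderiv I (fun y => mvfderiv I (g.onFields Z e) y (W y)) x v • e x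
        + mvfderiv I (fun y => mvfderiv I (g.onFields Z (fun y => J y (e y))) y (W y)) x v
          • J x (e x) := by
    intro W hW v
    refine he.leviCivita_eq h2 hsq hJ ((contMDiffAt_mvfderiv_field ha hW).mdifferentiableAt (by simp))
      ((contMDiffAt_mvfderiv_field hb hW).mdifferentiableAt (by simp)) ?_ v
    filter_upwards [he.eventually, hmd ha, hmd hb, hex.eventually_nhds] with y h1 h3 h4 h5
    exact h1.leviCivita_eq h2 hsq hJ h3 h4 h5 (W y)
  rw [curvature, key hX, key hY, he.leviCivita_eq h2 hsq hJ (ha.mdifferentiableAt (by simp))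
    (hb.mdifferentiableAt (by simp)) hex, mvfderiv_mlieBracket ha hX hY,
    mvfderiv_mlieBracket hb hX hY]
  module

lemma IsCommutingFrameNear.J_expand (h2 : Module.finrank ℝ E = 2)
    (hsq : ∀ (x : M) (v : TangentSpace I x), J x (J x v) = -v)
    (hJ : ∀ (x : M) (v w : TangentSpace I x), g.inner x (J x v) (J x w) = g.inner x v w)
    (he : IsCommutingFrameNear g J e x) (v : TangentSpace I x) :
    J x v = (-g.inner x v (J x (e x))) • e x + g.inner x v (e x) • J x (e x) := by
  conv_lhs => rw [he.expand h2 hsq hJ v]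
  simp only [map_add, map_smul, hsq]
  module

lemma IsCommutingFrameNear.smoothFieldAt_J (h2 : Module.finrank ℝ E = 2)
    (hsq : ∀ (x : M) (v : TangentSpace I x), J x (J x v) = -v)
    (hJ : ∀ (x : M) (v w : TangentSpace I x), g.inner x (J x v) (J x w) = g.inner x v w)
    (he : IsCommutingFrameNear g J e x) {Z : Π x : M, TangentSpace I x} (hZ : SmoothFieldAt Z x) :
    SmoothFieldAt (fun y => J y (Z y)) x :=
  ((SmoothFieldAt.smul (contMDiffAt_metric g hZ he.smooth_J.self_of_nhds).neg
    he.smooth.self_of_nhds).add (SmoothFieldAt.smul (contMDiffAt_metric g hZ he.smooth.self_of_nhds)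
    he.smooth_J.self_of_nhds)).congr
    (he.eventually.mono fun y hy => hy.J_expand h2 hsq hJ (Z y))

/-- J has constant matrix in the parallel frame (e, Je), hence is itself parallel. -/
lemma IsCommutingFrameNear.leviCivita_J (h2 : Module.finrank ℝ E = 2)
    (hsq : ∀ (x : M) (v : TangentSpace I x), J x (J x v) = -v)
    (hJ : ∀ (x : M) (v w : TangentSpace I x), g.inner x (J x v) (J x w) = g.inner x v w)
    (he : IsCommutingFrameNear g J e x) {Z : Π x : M, TangentSpace I x} (hZ : SmoothFieldAt Z x)
    (v : TangentSpace I x) :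
    leviCivita g (fun y => J y (Z y)) x v = J x (leviCivita g Z x v) := by
  have ha := (contMDiffAt_metric g hZ he.smooth.self_of_nhds).mdifferentiableAt (by simp)
  have hb := contMDiffAt_metric g hZ he.smooth_J.self_of_nhds
  have hb' := hb.neg.mdifferentiableAt (by simp)
  replace hb := hb.mdifferentiableAt (by simp)
  rw [he.leviCivita_eq h2 hsq hJ ha hb (he.eventually.mono fun y hy => hy.expand h2 hsq hJ (Z y)),
    he.leviCivita_eq h2 hsq hJ hb' ha (he.eventually.mono fun y hy => hy.J_expand h2 hsq hJ (Z y)),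
    mvfderiv_fun_neg]
  simp only [map_add, map_smul, hsq, neg_apply]
  module

/-- Replacing brackets by covariant derivatives, every term of the Nijenhuis tensor and of the
differential of g(·, J·) cancels once J commutes with ∇. -/
theorem isKahler_and_isFlat_of_commutingFrame [I.Boundaryless] (h2 : Module.finrank ℝ E = 2)
    (hsq : ∀ (x : M) (v : TangentSpace I x), J x (J x v) = -v)
    (hJ : ∀ (x : M) (v w : TangentSpace I x), g.inner x (J x v) (J x w) = g.inner x v w)
    (he : ∀ x, ∃ e, IsCommutingFrameNear g J e x) : IsKahler g J ∧ IsFlat g := by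
  refine ⟨⟨fun x => ?_, hsq, hJ, fun x X Y hX hY => ?_, fun x X Y Z hX hY hZ => ?_⟩,
    fun x X Y Z hX hY hZ => ?_⟩
  · obtain ⟨e, he⟩ := he x
    exact contMDiffAt_hom_of_apply fun Z hZ => he.smoothFieldAt_J h2 hsq hJ hZ
  · obtain ⟨e, he⟩ := he x
    have hX' := (he.smoothFieldAt_J h2 hsq hJ hX).mdifferentiableAt
    have hY' := (he.smoothFieldAt_J h2 hsq hJ hY).mdifferentiableAt
    have dX := hX.mdifferentiableAt
    have dY := hY.mdifferentiableAt
    rw [← leviCivita_torsion g hX' hY', ← leviCivita_torsion g hX' dY,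
      ← leviCivita_torsion g dX hY', ← leviCivita_torsion g dX dY]
    simp only [he.leviCivita_J h2 hsq hJ hX, he.leviCivita_J h2 hsq hJ hY, map_sub, hsq]
    module
  · obtain ⟨e, he⟩ := he x
    have hX' := (he.smoothFieldAt_J h2 hsq hJ hX).mdifferentiableAt
    have hY' := (he.smoothFieldAt_J h2 hsq hJ hY).mdifferentiableAt
    have hZ' := (he.smoothFieldAt_J h2 hsq hJ hZ).mdifferentiableAt
    have dX := hX.mdifferentiableAt
    have dY := hY.mdifferentiableAt
    have dZ := hZ.mdifferentiableAt
    have m1 : mvfderiv I (fun y => g.inner y (Y y) (J y (Z y))) x (X x) = _ :=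
      leviCivita_metric g dX dY hZ'
    have m2 : mvfderiv I (fun y => g.inner y (Z y) (J y (X y))) x (Y x) = _ :=
      leviCivita_metric g dY dZ hX'
    have m3 : mvfderiv I (fun y => g.inner y (X y) (J y (Y y))) x (Z x) = _ :=
      leviCivita_metric g dZ dX hY'
    rw [he.leviCivita_J h2 hsq hJ hZ] at m1
    rw [he.leviCivita_J h2 hsq hJ hX] at m2
    rw [he.leviCivita_J h2 hsq hJ hY] at m3
    simp only [dTwo, fundamentalForm]
    rw [← leviCivita_torsion g dX dY, ← leviCivita_torsion g dY dZ, ← leviCivita_torsion g dZ dX]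
    simp only [map_sub, sub_apply]
    have s := inner_J hsq hJ x
    have k1 := s (Y x) (leviCivita g Z x (X x))
    have k2 := s (Z x) (leviCivita g X x (Y x))
    have k3 := s (X x) (leviCivita g Y x (Z x))
    linear_combination m1 + m2 + m3 + k1 + k2 + k3
  · obtain ⟨e, he⟩ := he x
    exact he.curvature_eq_zero h2 hsq hJ hX hY hZ

end AlmostKenmotsu

end

noncomputable section
open Filter Topology
namespace AlmostKenmotsu
variable {E : Type*} [NormedAddCommGroup E] [NormedSpace ℝ E]
  {H : Type*} [TopologicalSpace H] {I : ModelWithCorners ℝ E H}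
  {M : Type*} [TopologicalSpace M] [ChartedSpace H M] [IsManifold I ∞ M] [FiniteDimensional ℝ E]

/-! ### Existence of orthonormal frames on surfaces -/

/-- Gram–Schmidt with smooth coefficients, valid where the vectors being normalised remain nonzero.
-/
lemma exists_orthonormalFrameNear_two (h2 : Module.finrank ℝ E = 2) (g : RiemannianMetric I M)
    (x : M) : ∃ u : Fin 2 → Π x : M, TangentSpace I x, IsOrthonormalFrameNear g u x := by
  have : FiniteDimensional ℝ (TangentSpace I x) := inferInstanceAs (FiniteDimensional ℝ E)
  have hd : Module.finrank ℝ (TangentSpace I x) = 2 := h2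
  have hnormalize : ∀ {W : Π x : M, TangentSpace I x}, (∀ᶠ y in 𝓝 x, SmoothFieldAt W y) → W x ≠ 0 →
      ∀ᶠ y in 𝓝 x, SmoothFieldAt (fun y => (√(g.inner y (W y) (W y)))⁻¹ • W y) y ∧
        g.inner y ((√(g.inner y (W y) (W y)))⁻¹ • W y) ((√(g.inner y (W y) (W y)))⁻¹ • W y) = 1 := by
    intro W hW hv
    have hc : ContinuousAt (g.onFields W W) x :=
      (contMDiffAt_metric g hW.self_of_nhds hW.self_of_nhds).continuousAt
    filter_upwards [hW, hc.eventually (lt_mem_nhds (g.pos x (W x) hv))] with y h1 h2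
    exact ⟨SmoothFieldAt.smul (contMDiffAt_inv_sqrt (contMDiffAt_metric g h1 h1) h2) h1,
      inner_normalize g h2⟩
  obtain ⟨v, hv⟩ : ∃ v : TangentSpace I x, v ≠ 0 := by
    by_contra! hcon
    have := finrank_le_one (R := ℝ) (0 : TangentSpace I x) fun w => ⟨0, by simp [hcon w]⟩
    omega
  obtain ⟨X, hX, rfl⟩ := exists_smooth_extension v
  have hu := hnormalize hX hv
  set u : Π x : M, TangentSpace I x := fun y => (√(g.inner y (X y) (X y)))⁻¹ • X y
  obtain ⟨w, hw⟩ : ∃ w : TangentSpace I x, w - g.inner x w (u x) • u x ≠ 0 := by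
    by_contra! hcon
    have := finrank_le_one (R := ℝ) (u x) fun w => ⟨g.inner x w (u x), (sub_eq_zero.1 (hcon w)).symm⟩
    omega
  obtain ⟨Y, hY, rfl⟩ := exists_smooth_extension w
  set W : Π x : M, TangentSpace I x := fun y => Y y - g.inner y (Y y) (u y) • u y with hW
  have hWs : ∀ᶠ y in 𝓝 x, SmoothFieldAt W y := by
    filter_upwards [hY, hu] with y h1 h2
    exact h1.sub (SmoothFieldAt.smul (contMDiffAt_metric g h1 h2.1) h2.1)
  have hv' := hnormalize hWs hw
  refine ⟨![u, fun y => (√(g.inner y (W y) (W y)))⁻¹ • W y], ?_, ?_⟩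
  · filter_upwards [hu, hv'] with y h1 h2 i
    fin_cases i
    exacts [h1.1, h2.1]
  · filter_upwards [hu, hv'] with y h1 h2
    have h3 : g.inner y (u y) (W y) = 0 := by
      simp only [hW, map_sub, map_smul, smul_eq_mul]
      rw [show g.inner y (u y) (u y) = 1 from h1.2, g.symm y (u y)]
      ring
    have h1' : g.inner y (u y) (u y) = 1 := h1.2
    intro i j
    fin_cases i <;> fin_cases j
    · exact h1.2
    · simp [h3]
    · simp [g.symm y (W y), h3]
    · exact h2.2

/-! ### Lie brackets of related vector fields -/

section Related

variable {E₁ : Type*} [NormedAddCommGroup E₁] [NormedSpace ℝ E₁] [FiniteDimensional ℝ E₁]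
  {H₁ : Type*} [TopologicalSpace H₁] {I₁ : ModelWithCorners ℝ E₁ H₁}
  {N : Type*} [TopologicalSpace N] [ChartedSpace H₁ N] [IsManifold I₁ ∞ N]

lemma mvfderiv_comp_mfderiv {F : Type*} [NormedAddCommGroup F] [NormedSpace ℝ F] {u : M → F}
    {f : N → M} {q : N} (hu : MDiffAt u (f q)) (hf : MDifferentiableAt I₁ I f q)
    (v : TangentSpace I₁ q) :
    mvfderiv I₁ (fun p => u (f p)) q v = mvfderiv I u (f q) (mfderiv I₁ I f q v) := by
  have := mfderiv_comp q hu hf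
  simp only [mvfderiv]
  exact congrArg (fun T => T v) this

lemma mvfderiv_extChartAt_injective [I.Boundaryless] (x : M) :
    Function.Injective (mvfderiv I (extChartAt I x) x) := by
  have : IsManifold I 1 M := IsManifold.of_le (n := ∞) (by simp)
  have h := (isInvertible_mfderiv_extChartAt (I := I) (mem_extChartAt_source (I := I) x)).injective
  intro v w hvw
  exact h hvw

/-- Brackets of `f`-related vector fields are `f`-related. -/
lemma mfderiv_mlieBracket_of_related [I.Boundaryless] [I₁.Boundaryless] {f : N → M} {q : N}
    (hf : ContMDiffAt I₁ I ∞ f q) {X Y : Π q : N, TangentSpace I₁ q}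
    {X' Y' : Π x : M, TangentSpace I x} (hX : SmoothFieldAt X q) (hY : SmoothFieldAt Y q)
    (hX' : SmoothFieldAt X' (f q)) (hY' : SmoothFieldAt Y' (f q))
    (hXX : ∀ᶠ p in 𝓝 q, mfderiv I₁ I f p (X p) = X' (f p))
    (hYY : ∀ᶠ p in 𝓝 q, mfderiv I₁ I f p (Y p) = Y' (f p)) :
    mfderiv I₁ I f q (VectorField.mlieBracket I₁ X Y q) = VectorField.mlieBracket I X' Y' (f q) := by
  have : CompleteSpace E := FiniteDimensional.complete ℝ E
  have : CompleteSpace E₁ := FiniteDimensional.complete ℝ E₁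
  -- A tangent vector is determined by the derivatives of the chart, so the claim reduces to
  -- comparing commutators of derivations on u and u ∘ f.
  apply mvfderiv_extChartAt_injective (I := I) (f q)
  have hu : ContMDiffAt I 𝓘(ℝ, E) ∞ (extChartAt I (f q)) (f q) := contMDiffAt_extChartAt
  have hud : ∀ᶠ y in 𝓝 (f q), MDiffAt (extChartAt I (f q)) y := by
    have h1 : ContMDiffAt I 𝓘(ℝ, E) 1 (extChartAt I (f q)) (f q) := hu.of_le (by simp)
    filter_upwards [(contMDiffAt_iff_contMDiffAt_nhds (by simp)).1 h1] with y hy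
    exact hy.mdifferentiableAt (by simp)
  have hfd : ∀ᶠ p in 𝓝 q, MDifferentiableAt I₁ I f p := by
    have h1 : ContMDiffAt I₁ I 1 f q := hf.of_le (by simp)
    filter_upwards [(contMDiffAt_iff_contMDiffAt_nhds (by simp)).1 h1] with y hy
    exact hy.mdifferentiableAt (by simp)
  have key : ∀ {X Y : Π q : N, TangentSpace I₁ q} {X' Y' : Π x : M, TangentSpace I x},
      SmoothFieldAt Y' (f q) → mfderiv I₁ I f q (X q) = X' (f q) →
      (∀ᶠ p in 𝓝 q, mfderiv I₁ I f p (Y p) = Y' (f p)) →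
      mvfderiv I₁ (fun p => mvfderiv I₁ (fun p => extChartAt I (f q) (f p)) p (Y p)) q (X q)
        = mvfderiv I (fun y => mvfderiv I (extChartAt I (f q)) y (Y' y)) (f q) (X' (f q)) := by
    intro X Y X' Y' hY' hXX hYY
    rw [mvfderiv_congr (f' := fun p => mvfderiv I (extChartAt I (f q)) (f p) (Y' (f p))),
      mvfderiv_comp_mfderiv (u := fun y => mvfderiv I (extChartAt I (f q)) y (Y' y))
        ((contMDiffAt_mvfderiv_field hu hY').mdifferentiableAt (by simp)) hfd.self_of_nhds, hXX]
    filter_upwards [hYY, hfd, hf.continuousAt.eventually hud] with p h1 h2 h3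
    rw [mvfderiv_comp_mfderiv h3 h2, h1]
  rw [← mvfderiv_comp_mfderiv hud.self_of_nhds hfd.self_of_nhds,
    mvfderiv_mlieBracket (f := fun p => extChartAt I (f q) (f p)) (hu.comp q hf) hX hY,
    mvfderiv_mlieBracket hu hX' hY', key hY' hXX.self_of_nhds hYY, key hX' hYY.self_of_nhds hXX]

end Related

end AlmostKenmotsu

end

noncomputable section
open Filter Topology
namespace AlmostKenmotsu
variable {E : Type*} [NormedAddCommGroup E] [NormedSpace ℝ E]
  {H : Type*} [TopologicalSpace H] {I : ModelWithCorners ℝ E H}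
  {M : Type*} [TopologicalSpace M] [ChartedSpace H M] [IsManifold I ∞ M] [FiniteDimensional ℝ E]
  {E₁ : Type*} [NormedAddCommGroup E₁] [NormedSpace ℝ E₁] [FiniteDimensional ℝ E₁]
  {H₁ : Type*} [TopologicalSpace H₁] {I₁ : ModelWithCorners ℝ E₁ H₁}
  {N : Type*} [TopologicalSpace N] [ChartedSpace H₁ N] [IsManifold I₁ ∞ N]

/-! ### Pulling back along an immersion -/

lemma exists_leftInverse_mfderiv {f : N → M} {q : N}
    (hf : Function.Injective (mfderiv I₁ I f q)) :
    ∃ L : TangentSpace I (f q) →L[ℝ] TangentSpace I₁ q, ∀ v, L (mfderiv I₁ I f q v) = v := by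
  have : FiniteDimensional ℝ (TangentSpace I (f q)) := inferInstanceAs (FiniteDimensional ℝ E)
  have : T2Space (TangentSpace I (f q)) := inferInstanceAs (T2Space E)
  obtain ⟨L, hL⟩ := LinearMap.exists_leftInverse_of_injective (mfderiv I₁ I f q).toLinearMap
    (LinearMap.ker_eq_bot.2 hf)
  exact ⟨LinearMap.toContinuousLinearMap L, fun v => LinearMap.congr_fun hL v⟩

/-- The pointwise pull-back of a metric by the differential of `f`. -/
def pullbackInner (g : RiemannianMetric I M) (f : N → M) (q : N) :
    TangentSpace I₁ q →L[ℝ] TangentSpace I₁ q →L[ℝ] ℝ :=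
  ContinuousLinearMap.bilinearComp (E := E) (F := E) (E' := E₁) (F' := E₁)
    (g.inner (f q)) (mfderiv I₁ I f q) (mfderiv I₁ I f q)

lemma contMDiffAt_metric_along (g : RiemannianMetric I M) {f : N → M} {q : N}
    (hf : ContMDiffAt I₁ I ∞ f q) {X Y : Π q : N, TangentSpace I (f q)}
    (hX : ContMDiffAt I₁ I.tangent ∞ (fun p => (⟨f p, X p⟩ : TangentBundle I M)) q)
    (hY : ContMDiffAt I₁ I.tangent ∞ (fun p => (⟨f p, Y p⟩ : TangentBundle I M)) q) :
    ContMDiffAt I₁ 𝓘(ℝ, ℝ) ∞ (fun p => g.inner (f p) (X p) (Y p)) q := by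
  have h : ContMDiffAt I₁ (I.prod 𝓘(ℝ, ℝ)) ∞
      (fun p ↦ TotalSpace.mk' ℝ (E := Bundle.Trivial M ℝ) (f p) (g.inner (f p) (X p) (Y p))) q :=
    ContMDiffAt.clm_bundle_apply₂ (F₁ := E) (F₂ := E) (b := f)
      ((g.contMDiff (f q)).comp q hf) hX hY
  simp only [contMDiffAt_totalSpace] at h
  exact h.2

/-- The metric induced by an immersion. -/
def pullbackMetric (g : RiemannianMetric I M) {f : N → M} (hf : ContMDiff I₁ I ∞ f)
    (hinj : ∀ q, Function.Injective (mfderiv I₁ I f q)) : RiemannianMetric I₁ N where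
  inner q := pullbackInner g f q
  symm q v w := g.symm _ _ _
  pos q v hv := g.pos _ _ fun h => hv (hinj q (h.trans (map_zero _).symm))
  isVonNBounded q := by
    obtain ⟨L, hL⟩ := exists_leftInverse_mfderiv (hinj q)
    -- The pulled-back unit ball lies in the image, under a continuous left inverse of the
    -- differential, of the bounded unit ball of g.
    have hsub : {v | pullbackInner (I₁ := I₁) g f q v v < 1}
        ⊆ L '' {w : TangentSpace I (f q) | g.inner (f q) w w < 1} :=
      fun v hv => ⟨mfderiv I₁ I f q v, hv, hL v⟩
    exact ((g.isVonNBounded (f q)).image L).subset hsub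
  contMDiff q := by
    refine contMDiffAt_hom_of_apply fun X hX => contMDiffAt_hom_of_apply fun Y hY => ?_
    rw [contMDiffAt_section]
    exact contMDiffAt_metric_along g (hf q) (contMDiffAt_mfderiv_field (hf q) hX)
      (contMDiffAt_mfderiv_field (hf q) hY)

/-- A field on `N` whose image under `df` is smooth along `f` is smooth. -/
lemma smoothFieldAt_of_mfderiv (h2 : Module.finrank ℝ E₁ = 2) (g : RiemannianMetric I M)
    {f : N → M} (hf : ContMDiff I₁ I ∞ f) (hinj : ∀ q, Function.Injective (mfderiv I₁ I f q))
    {X : Π q : N, TangentSpace I₁ q} {q : N}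
    (hX : ContMDiffAt I₁ I.tangent ∞ (fun p => (⟨f p, mfderiv I₁ I f p (X p)⟩ : TangentBundle I M)) q) :
    SmoothFieldAt X q := by
  obtain ⟨u, hu⟩ := exists_orthonormalFrameNear_two h2 (pullbackMetric g hf hinj) q
  exact hu.smoothFieldAt h2 fun j => contMDiffAt_metric_along g (hf q) hX
    (contMDiffAt_mfderiv_field (hf q) (hu.smooth.self_of_nhds j))

/-! ### Induced structure on integral manifolds of the canonical distribution -/

namespace AlmostContactMetric

variable {S : AlmostContactMetric I M} {i : N → M}

/-- φ takes values in ker η, which is the image of the differential, so a left inverse of the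
differential brings it back. -/
lemma IsIntegralManifold.exists_endo (hi : S.IsIntegralManifold I₁ i) (q : N) :
    ∃ J : TangentSpace I₁ q →L[ℝ] TangentSpace I₁ q,
      ∀ v, mfderiv I₁ I i q (J v) = S.φ (i q) (mfderiv I₁ I i q v) := by
  obtain ⟨L, hL⟩ := exists_leftInverse_mfderiv (hi.immersion q)
  refine ⟨L ∘L S.φ (i q) ∘L mfderiv I₁ I i q, fun v => ?_⟩
  obtain ⟨w, hw⟩ : S.φ (i q) (mfderiv I₁ I i q v) ∈ Set.range (mfderiv I₁ I i q) := by
    rw [hi.tangent]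
    exact S.η_φ _ _
  simp only [ContinuousLinearMap.comp_apply, ← hw, hL]

lemma IsIntegralManifold.η_mfderiv (hi : S.IsIntegralManifold I₁ i) (q : N)
    (v : TangentSpace I₁ q) : S.η (i q) (mfderiv I₁ I i q v) = 0 := by
  have : mfderiv I₁ I i q v ∈ Set.range (mfderiv I₁ I i q) := ⟨v, rfl⟩
  rw [hi.tangent] at this
  exact this

/-- The horizontal fields V and φV are tangent to N. Their lifts are smooth because the map is an
immersion, and the bracket of the lifts maps to [V, φV] = 0. -/
lemma IsIntegralManifold.exists_isCommutingFrameNear [I.Boundaryless] [I₁.Boundaryless]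
    (h2 : Module.finrank ℝ E₁ = 2)
    (hi : S.IsIntegralManifold I₁ i) {G : RiemannianMetric I₁ N}
    {J : Π q : N, TangentSpace I₁ q →L[ℝ] TangentSpace I₁ q} (hGJ : S.IsInduced i G J) {q : N}
    {V : Π x : M, TangentSpace I x} (hV : S.UnitHorizontalNear V (i q))
    (hb : ∀ᶠ y in 𝓝 (i q), VectorField.mlieBracket I V (fun y => S.φ y (V y)) y = 0) :
    ∃ e, IsCommutingFrameNear G J e q := by
  -- The lift is chosen at every point of N; where V is not horizontal its value is arbitrary, which
  -- is harmless since V is horizontal near the point considered.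
  have hex : ∀ p : N, ∃ w : TangentSpace I₁ p, S.η (i p) (V (i p)) = 0 →
      mfderiv I₁ I i p w = V (i p) := by
    intro p
    by_cases h : S.η (i p) (V (i p)) = 0
    · have h' : V (i p) ∈ Set.range (mfderiv I₁ I i p) := by
        rw [hi.tangent]
        exact h
      obtain ⟨w, hw⟩ := h'
      exact ⟨w, fun _ => hw⟩
    · exact ⟨0, fun h' => absurd h' h⟩
  choose e he using hex
  have hVN : ∀ᶠ p in 𝓝 q, S.UnitHorizontalNear V (i p) :=
    hi.smooth.continuous.continuousAt.eventually hV.eventually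
  have hbN : ∀ᶠ p in 𝓝 q, VectorField.mlieBracket I V (fun y => S.φ y (V y)) (i p) = 0 :=
    hi.smooth.continuous.continuousAt.eventually hb
  have hd : ∀ᶠ p in 𝓝 q, mfderiv I₁ I i p (e p) = V (i p) :=
    hVN.mono fun p hp => he p hp.self_of_nhds.2.2
  have hd' : ∀ᶠ p in 𝓝 q, mfderiv I₁ I i p (J p (e p)) = S.φ (i p) (V (i p)) := by
    filter_upwards [hd] with p hp
    rw [hGJ.endo, hp]
  have hlift : ∀ {X : Π q : N, TangentSpace I₁ q} {W : Π x : M, TangentSpace I x} {p : N},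
      SmoothFieldAt W (i p) → (∀ᶠ r in 𝓝 p, mfderiv I₁ I i r (X r) = W (i r)) →
      SmoothFieldAt X p := by
    intro X W p hW hXW
    refine smoothFieldAt_of_mfderiv h2 S.g hi.smooth hi.immersion ?_
    have h1 : ContMDiffAt I₁ I.tangent ∞ (fun r => (⟨i r, W (i r)⟩ : TangentBundle I M)) p :=
      ContMDiffAt.comp p hW (hi.smooth p)
    exact h1.congr_of_eventuallyEq (hXW.mono fun r hr => by simp [hr])
  have hs : ∀ᶠ p in 𝓝 q, SmoothFieldAt e p := by
    filter_upwards [hVN, hd.eventually_nhds] with p h1 h3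
    exact hlift h1.self_of_nhds.1 h3
  have hs' : ∀ᶠ p in 𝓝 q, SmoothFieldAt (fun p => J p (e p)) p := by
    filter_upwards [hVN, hd'.eventually_nhds] with p h1 h3
    exact hlift h1.phi.self_of_nhds.1 h3
  refine ⟨e, hs, hs', ?_, ?_⟩
  · filter_upwards [hVN, hd] with p h1 h3
    rw [hGJ.metric, h3, h1.self_of_nhds.2.1]
  · filter_upwards [hVN, hs, hs', hd.eventually_nhds, hd'.eventually_nhds, hbN] with p h1 h3 h4 h5 h6 h7
    apply hi.immersion p
    rw [mfderiv_mlieBracket_of_related (hi.smooth p) h3 h4 h1.self_of_nhds.1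
      h1.phi.self_of_nhds.1 h5 h6, h7, map_zero]

theorem IsIntegralManifold.exists_flat_kahler [I.Boundaryless] [I₁.Boundaryless]
    (h3 : Module.finrank ℝ E = 3) (h2 : Module.finrank ℝ E₁ = 2) (hS : S.IsAlmostKenmotsu)
    {k μ : M → ℝ} (hnull : S.IsGeneralizedKMu k μ ∨ S.IsGeneralizedKMu' k μ)
    (hdk : ∀ (x : M) (v w : TangentSpace I x), wedgeOneOne (mvfderiv I k x) (S.η x) v w = 0)
    (hk : ∀ x, k x < -1) (hi : S.IsIntegralManifold I₁ i) :
    ∃ (G : RiemannianMetric I₁ N) (J : Π q : N, TangentSpace I₁ q →L[ℝ] TangentSpace I₁ q),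
      S.IsInduced i G J ∧ IsKahler G J ∧ IsFlat G := by
  choose J hJ using hi.exists_endo
  have hGJ : S.IsInduced i (pullbackMetric S.g hi.smooth hi.immersion) J := ⟨fun _ _ _ => rfl, hJ⟩
  refine ⟨pullbackMetric S.g hi.smooth hi.immersion, J, hGJ,
    isKahler_and_isFlat_of_commutingFrame h2 (fun q v => ?_) (fun q v w => ?_) fun q => ?_⟩
  · apply hi.immersion q
    rw [hJ, hJ, S.φ_φ (hi.η_mfderiv q v), map_neg]
  · rw [hGJ.metric, hGJ.metric, hJ, hJ, S.compatible, hi.η_mfderiv]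
    simp
  · obtain ⟨V, hV, hb⟩ := exists_commuting_unitHorizontalNear h3 hS hnull hdk hk (i q)
    exact hi.exists_isCommutingFrameNear h2 hGJ hV hb

end AlmostContactMetric
end AlmostKenmotsu
end

/-! ### The theorem for leaves -/

theorem proposition6p1 {M : Type*} [TopologicalSpace M] [T2Space M] [SecondCountableTopology M]
    [ConnectedSpace M] [ChartedSpace (EuclideanSpace ℝ (Fin 3)) M] [IsManifold (𝓡 3) ∞ M]
    (S : AlmostKenmotsu.AlmostContactMetric (𝓡 3) M) (hS : S.IsAlmostKenmotsu)
    (k μ : M → ℝ) (hnull : S.IsGeneralizedKMu k μ ∨ S.IsGeneralizedKMu' k μ)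
    (hdk : ∀ (x : M) (v w : TangentSpace (𝓡 3) x),
      AlmostKenmotsu.wedgeOneOne (mvfderiv (𝓡 3) k x) (S.η x) v w = 0)
    (hk : ∀ x : M, k x < -1)
    {N : Type*} [TopologicalSpace N] [ChartedSpace (EuclideanSpace ℝ (Fin 2)) N]
    [IsManifold (𝓡 2) ∞ N] (i : N → M) (hi : S.IsLeaf (𝓡 2) i) :
    ∃ (G : AlmostKenmotsu.RiemannianMetric (𝓡 2) N)
      (J : Π q : N, TangentSpace (𝓡 2) q →L[ℝ] TangentSpace (𝓡 2) q),
      S.IsInduced i G J ∧ AlmostKenmotsu.IsKahler G J ∧ AlmostKenmotsu.IsFlat G :=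
  hi.toIsIntegralManifold.exists_flat_kahler finrank_euclideanSpace_fin finrank_euclideanSpace_fin
    hS hnull hdk hk
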